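/- Let $g\ge 1$, and let $\Gamma$ be a chain of $g$ cycles: a metric graph consisting of cycles $C_1,\dots,C_g$ with two distinct points $v_i,w_i$ on each cycle $C_i$ and, for $1\le i<g$, a bridge joining $w_i$ to $v_{i+1}$; all edge lengths are arbitrary positive real numbers, and bridges of length $0$ (that is, $w_i=v_{i+1}$) are also allowed. Let $\ell_i$ be the length of $C_i$ and $\ell(v_iw_i)$ the length of the clockwise edge from $v_i$ to $w_i$. The torsion order $m_i$ is $0$ if $\ell(v_iw_i)$ is an irrational multiple of $\ell_i$, and otherwise it is the least positive integer such that $m_i\,\ell(v_iw_i)$ is an integer multiple of $\ell_i$. Let $W^r_d(\Gamma)\subseteq \operatorname{Pic}^d(\Gamma)$ be the set of classes of divisors of degree $d$ and Baker–Norine rank at least $r$. Call $\Gamma$ Brill–Noether general if, for all integers $r\ge 0$ and $d$ with $g-d+r\ge 0$, the locus $W^r_d(\Gamma)$ is nonempty of dimension $\rho=g-(r+1)(g-d+r)$ when $\rho\ge 0$, and is empty when $\rho<0$. (Here $\operatorname{Pic}^d(\Gamma)$ is regarded as a real torus of dimension $g$ through the Abel–Jacobi map.) Theorem. $\Gamma$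 is Brill–Noether general if and only if for each $i\in\{2,3,\dots,g-1\}$ either $m_i=0$ or $m_i>\min(i,\,g+1-i)$. -/

import Mathlib

open scoped Topology

noncomputable section

namespace Tropical

/-- A (model of a) compact metric graph: a finite multigraph, loops and parallel edges allowed,
whose edges are oriented for reference and carry positive real lengths.  The edge `e` is the
segment `[0, len e]`, with `0` glued to the vertex `src e` and `len e` to the vertex `tgt e`. -/
structure MetricGraph (V E : Type) where
  src : E → V
  tgt : E → V
  len : E → ℝ
  len_pos : ∀ e, 0 < len e

namespace MetricGraph

variable {V E : Type}

/-- The points of the metric graph: the vertices, and the interior points of the edges. -/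
def Point (Γ : MetricGraph V E) : Type :=
  V ⊕ (Σ e : E, Set.Ioo (0 : ℝ) (Γ.len e))

open Classical in
/-- The point at distance `t` from the start of the edge `e` (for `0 ≤ t ≤ len e`). -/
def pt (Γ : MetricGraph V E) (e : E) (t : ℝ) : Γ.Point :=
  if h : t ∈ Set.Ioo (0 : ℝ) (Γ.len e) then Sum.inr ⟨e, ⟨t, h⟩⟩
  else if t ≤ 0 then Sum.inl (Γ.src e) else Sum.inl (Γ.tgt e)

/-- The genus (first Betti number) `|E| - |V| + 1` of a connected graph. -/
def genus (_Γ : MetricGraph V E) : ℤ := (Nat.card E : ℤ) - Nat.card V + 1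

/-- Divisors: finitely supported integer combinations of points. -/
abbrev Divisor (Γ : MetricGraph V E) : Type := Γ.Point →₀ ℤ

/-- The degree of a divisor. -/
def degree {Γ : MetricGraph V E} (D : Γ.Divisor) : ℤ := D.sum fun _ n => n

/-- Effective divisors: all coefficients are nonnegative. -/
def Effective {Γ : MetricGraph V E} (D : Γ.Divisor) : Prop := ∀ p, 0 ≤ D p

/-- A family of functions `val e`, one on each edge `[0, len e]`, that are continuous and
piecewise linear with integer slopes; `right e t` and `left e t` are the slopes of `val e`
immediately after and immediately before `t`.  (By compactness of `[0, len e]` there are only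
finitely many linear pieces.)  The values on different edges need not agree at the vertices.
The derivatives of the `val e` are piecewise constant integer functions on the edges, so such
a family is the same as an integral `1`-chain on the metric graph with a primitive on each
edge. -/
structure EdgePL (Γ : MetricGraph V E) where
  val : E → ℝ → ℝ
  right : E → ℝ → ℤ
  left : E → ℝ → ℤ
  right_spec : ∀ e, ∀ t ∈ Set.Ico 0 (Γ.len e), ∀ᶠ u in 𝓝[>] t,
    val e u = val e t + right e t * (u - t)
  left_spec : ∀ e, ∀ t ∈ Set.Ioc 0 (Γ.len e), ∀ᶠ u in 𝓝[<] t,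
    val e u = val e t + left e t * (u - t)

open Classical in
/-- The sum of the outgoing slopes at a point, over all tangent directions at that point. -/
def EdgePL.ord [Fintype E] {Γ : MetricGraph V E} (F : Γ.EdgePL) : Γ.Point → ℤ
  | Sum.inl v => (∑ e, if Γ.src e = v then F.right e 0 else 0)
      - ∑ e, if Γ.tgt e = v then F.left e (Γ.len e) else 0
  | Sum.inr ⟨e, t⟩ => F.right e t - F.left e t

/-- `F` is the restriction to the edges of the function `f` on the metric graph; so `f` is a
rational function: continuous and piecewise linear with integer slopes. -/
def EdgePL.IsRestriction {Γ : MetricGraph V E} (F : Γ.EdgePL) (f : Γ.Point → ℝ) : Prop :=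
  ∀ e, ∀ t ∈ Set.Icc 0 (Γ.len e), F.val e t = f (Γ.pt e t)

/-- The group of principal divisors `div f`, for `f` a rational function on the metric graph. -/
def principal [Fintype E] (Γ : MetricGraph V E) : AddSubgroup Γ.Divisor where
  carrier := {D | ∃ (f : Γ.Point → ℝ) (F : Γ.EdgePL), F.IsRestriction f ∧ ∀ p, D p = F.ord p}
  zero_mem' := by
    refine ⟨0, ⟨0, 0, 0, by simp, by simp⟩, by simp [EdgePL.IsRestriction], ?_⟩
    intro p
    rw [Finsupp.zero_apply]
    rcases p with v | ⟨e, t⟩ <;> simp [EdgePL.ord]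
  add_mem' := by
    rintro D D' ⟨f, F, hf, hD⟩ ⟨f', F', hf', hD'⟩
    refine ⟨f + f', ⟨F.val + F'.val, F.right + F'.right, F.left + F'.left, ?_, ?_⟩, ?_, ?_⟩
    · intro e t ht
      filter_upwards [F.right_spec e t ht, F'.right_spec e t ht] with u h h'
      simp only [Pi.add_apply, h, h', Int.cast_add]
      ring
    · intro e t ht
      filter_upwards [F.left_spec e t ht, F'.left_spec e t ht] with u h h'
      simp only [Pi.add_apply, h, h', Int.cast_add]
      ring
    · intro e t ht
      simp [hf e t ht, hf' e t ht]
    · intro p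
      rw [Finsupp.add_apply, hD, hD']
      rcases p with v | ⟨e, t⟩
      · simp only [EdgePL.ord, Pi.add_apply, ← Finset.sum_filter, Finset.sum_add_distrib]
        ring
      · simp only [EdgePL.ord, Pi.add_apply]
        ring
  neg_mem' := by
    rintro D ⟨f, F, hf, hD⟩
    refine ⟨-f, ⟨-F.val, -F.right, -F.left, ?_, ?_⟩, ?_, ?_⟩
    · intro e t ht
      filter_upwards [F.right_spec e t ht] with u h
      simp only [Pi.neg_apply, h, Int.cast_neg]
      ring
    · intro e t ht
      filter_upwards [F.left_spec e t ht] with u h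
      simp only [Pi.neg_apply, h, Int.cast_neg]
      ring
    · intro e t ht
      simp [hf e t ht]
    · intro p
      rw [Finsupp.neg_apply, hD]
      rcases p with v | ⟨e, t⟩
      · simp only [EdgePL.ord, Pi.neg_apply, ← Finset.sum_filter, Finset.sum_neg_distrib]
        ring
      · simp only [EdgePL.ord, Pi.neg_apply]
        ring

/-- The Picard group: divisors modulo linear equivalence. -/
abbrev Pic [Fintype E] (Γ : MetricGraph V E) : Type := Γ.Divisor ⧸ Γ.principal

/-- The divisor class of `D`. -/
def cls [Fintype E] {Γ : MetricGraph V E} (D : Γ.Divisor) : Γ.Pic := QuotientAddGroup.mk D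

/-- The Baker--Norine rank of `D` is at least `r`: for every effective divisor `A` of degree `r`,
the divisor `D - A` is linearly equivalent to an effective divisor. -/
def RankAtLeast [Fintype E] {Γ : MetricGraph V E} (D : Γ.Divisor) (r : ℕ) : Prop :=
  ∀ A : Γ.Divisor, Effective A → degree A = r →
    ∃ B : Γ.Divisor, Effective B ∧ cls B = cls (D - A)

/-- The Brill--Noether locus `W^r_d(Γ)`: classes of divisors of degree `d` and rank at least
`r`. -/
def brillNoetherLocus [Fintype E] (Γ : MetricGraph V E) (r : ℕ) (d : ℤ) : Set Γ.Pic :=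
  {c | ∃ D : Γ.Divisor, degree D = d ∧ RankAtLeast D r ∧ cls D = c}

open Classical in
/-- The space `Ω(Γ)` of harmonic `1`-forms `∑ ω e • de`: at each vertex, inflow equals outflow. -/
def harmonicForms [Fintype E] (Γ : MetricGraph V E) : Submodule ℝ (E → ℝ) where
  carrier := {ω | ∀ v, (∑ e, if Γ.src e = v then ω e else 0) =
    ∑ e, if Γ.tgt e = v then ω e else 0}
  zero_mem' := by simp
  add_mem' := by
    intro a b ha hb v
    have h1 := ha v
    have h2 := hb v
    simp only [← Finset.sum_filter, Pi.add_apply, Finset.sum_add_distrib] at h1 h2 ⊢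
    rw [h1, h2]
  smul_mem' := by
    intro c a ha v
    have h1 := ha v
    simp only [← Finset.sum_filter, Pi.smul_apply, ← Finset.smul_sum] at h1 ⊢
    rw [h1]

/-- Let `d` be the degree of `D₀`.  By the Abel--Jacobi map with base divisor `D₀`, the component
`Pic^d(Γ)` of the Picard group is the real torus `Ω(Γ)^* / H₁(Γ, ℤ)`; it sends the class of `D` to
the functional `ω ↦ ∫_c ω` for any integral `1`-chain `c` with boundary `D - D₀`.
For a set `S` of classes this is the preimage of `S` in the universal cover `Ω(Γ)^*`.
Here `c` is the derivative of `F`; its boundary is minus the sum of outgoing slopes, and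
its integral over the edge `e` is `F.val e (len e) - F.val e 0`. -/
def univCoverLift [Fintype E] (Γ : MetricGraph V E) (D₀ : Γ.Divisor) (S : Set Γ.Pic) :
    Set (Γ.harmonicForms →L[ℝ] ℝ) :=
  {x | ∃ D : Γ.Divisor, cls D ∈ S ∧ ∃ F : Γ.EdgePL, (∀ p, (D - D₀) p = - F.ord p) ∧
    ∀ ω : Γ.harmonicForms, x ω = ∑ e, (ω : E → ℝ) e * (F.val e (Γ.len e) - F.val e 0)}

/-- The set `S ⊆ Pic^d(Γ)` is nonempty of dimension `n`.  Dimension is Hausdorff dimension in the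
flat torus `Pic^d(Γ)`, measured in its universal cover.  (On locally finite
unions of polyhedra it is the usual dimension.  It depends neither on the norm nor on the
base divisor.) -/
def HasDimension [Fintype E] (Γ : MetricGraph V E) (d : ℤ) (S : Set Γ.Pic) (n : ℕ) : Prop :=
  S.Nonempty ∧ ∀ D₀ : Γ.Divisor, degree D₀ = d → dimH (Γ.univCoverLift D₀ S) = n

/-- Brill--Noether generality: for all `r ≥ 0` and `d` with `g - d + r ≥ 0`, the locus `W^r_d(Γ)`
has dimension `ρ = g - (r + 1) (g - d + r)` if `ρ ≥ 0`, and is empty if `ρ < 0`. -/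
def IsBrillNoetherGeneral [Fintype E] (Γ : MetricGraph V E) : Prop :=
  ∀ (r : ℕ) (d : ℤ), 0 ≤ Γ.genus - d + r →
    (∀ n : ℕ, (n : ℤ) = Γ.genus - (r + 1) * (Γ.genus - d + r) →
      Γ.HasDimension d (Γ.brillNoetherLocus r d) n) ∧
    (Γ.genus - (r + 1) * (Γ.genus - d + r) < 0 → Γ.brillNoetherLocus r d = ∅)

end MetricGraph

/-- Edge lengths of a chain of `g` cycles (indexed by `0, …, g - 1`).  The cycle `i` has two
distinct marked points `v i` and `w i`; `arc i` is the length of the clockwise edge from `v i` to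
`w i`, and `coarc i` that of the clockwise edge from `w i` to `v i`.  A bridge of length `bridge k`
joins `w k` to `v (k + 1)`; length `0` means that these two points coincide. -/
structure ChainOfCycles (g : ℕ) where
  arc : Fin g → ℝ
  coarc : Fin g → ℝ
  bridge : Fin (g - 1) → ℝ
  arc_pos : ∀ i, 0 < arc i
  coarc_pos : ∀ i, 0 < coarc i
  bridge_nonneg : ∀ k, 0 ≤ bridge k

namespace ChainOfCycles

variable {g : ℕ}

/-- The point `v i` coincides with `w (i - 1)`: the bridge between them has length `0`. -/
def Merged (C : ChainOfCycles g) (i : Fin g) : Prop :=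
  ∃ k : Fin (g - 1), (k : ℕ) + 1 = i ∧ C.bridge k = 0

/-- The vertices: all `w i`, and those `v i` that are different from `w (i - 1)`. -/
abbrev Vertex (C : ChainOfCycles g) : Type := Fin g ⊕ {i : Fin g // ¬ C.Merged i}

/-- The edges: the arcs from `v i` to `w i`, the arcs from `w i` to `v i`, and the bridges of
positive length. -/
abbrev Edge (C : ChainOfCycles g) : Type :=
  Fin g ⊕ Fin g ⊕ {k : Fin (g - 1) // 0 < C.bridge k}

/-- The vertex `w i`. -/
def w (C : ChainOfCycles g) (i : Fin g) : C.Vertex := Sum.inl i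

open Classical in
/-- The vertex `v i`. -/
def v (C : ChainOfCycles g) (i : Fin g) : C.Vertex :=
  if h : C.Merged i then C.w ⟨(i : ℕ) - 1, by omega⟩ else Sum.inr ⟨i, h⟩

/-- The chain of cycles as a metric graph. -/
def graph (C : ChainOfCycles g) : MetricGraph C.Vertex C.Edge where
  src
    | Sum.inl i => C.v i
    | Sum.inr (Sum.inl i) => C.w i
    | Sum.inr (Sum.inr k) => C.w ⟨(k.1 : ℕ), by omega⟩
  tgt
    | Sum.inl i => C.w i
    | Sum.inr (Sum.inl i) => C.v i
    | Sum.inr (Sum.inr k) => C.v ⟨(k.1 : ℕ) + 1, by omega⟩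
  len
    | Sum.inl i => C.arc i
    | Sum.inr (Sum.inl i) => C.coarc i
    | Sum.inr (Sum.inr k) => C.bridge k.1
  len_pos
    | Sum.inl i => C.arc_pos i
    | Sum.inr (Sum.inl i) => C.coarc_pos i
    | Sum.inr (Sum.inr k) => k.2

/-- The length of the cycle `i`. -/
def cycleLength (C : ChainOfCycles g) (i : Fin g) : ℝ := C.arc i + C.coarc i

open Classical in
/-- The torsion order of the cycle `i`: it is `0` if `arc i` is an irrational multiple of the
length of the cycle, and otherwise the least positive integer `m` such that `m * arc i` is an
integer multiple of that length. -/
def torsionOrder (C : ChainOfCycles g) (i : Fin g) : ℕ :=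
  if Irrational (C.arc i / C.cycleLength i) then 0
  else sInf {m : ℕ | 0 < m ∧ ∃ k : ℤ, (m : ℝ) * C.arc i = k * C.cycleLength i}

end ChainOfCycles

end Tropical

end

/-! Projecting a divisor to each cycle gives a coordinate `x i` in the circle `ℝ/ℓ_i`. The degree
and these coordinates determine the divisor class (`cls_eq_cls_iff`), and all values occur, so
`Pic^d` is a product of `g` circles. An effective divisor is governed by its chip counts. A cycle
carrying a chip can realise any coordinate, while an empty cycle forces `x i` to be the number of
chips to its right times the class of `arc i` (`exists_isProfile`, `IsProfile.exists_effective`).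

Rank thus becomes a game. An adversary removes `r` chips, and walking along the chain costs one chip
per cycle, except at cycles whose coordinate has the exact value that lets all chips pass. Recording
those free cycles, with row `j` for the state after `j` removals, turns rank at least `r` into the
existence of a tableau of shape `(r + 1) × (g - d + r)` whose symbols are cycles. A symbol `i`
(counted from 0) in row `j` and column `k` imposes `x i = (d - i + k - j) • arcClass i`
(`rankAtLeast_of_isTableau`, `exists_isTableau_of_rankAtLeast`). Hence `W^r_d` is a finite union of
coordinate tori, and a nonempty one has codimension the number of distinct symbols
(`dimH_torusLift`).

The dimension is therefore the expected one as long as symbols do not repeat. Two occurrences of `i`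
are compatible only if their content difference kills `arcClass i`, that is, is a multiple of the
torsion order. A repetition of minimal content difference `n` forces `n - 1` distinct smaller
symbols and `n - 1` distinct larger ones, so large torsion orders exclude it
(`OnTorus.eq_of_eq_symbol`). Conversely, a small torsion order `m` leaves room for a `2 × m` tableau
with a repeated symbol, which violates generality for `r = 1` (`not_isBrillNoetherGeneral`). The two
end cycles impose nothing, because a torsion order is never 1. -/

namespace Tropical

/-! ### Piecewise linear functions on an interval. -/

section PiecewiseLinear

/-- `H` is piecewise linear on `[0, L]` with right slopes `R` and left slopes `S`. -/
structure HasSlopes (L : ℝ) (H : ℝ → ℝ) (R S : ℝ → ℤ) : Prop where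
  right : ∀ t ∈ Set.Ico 0 L, ∀ᶠ u in 𝓝[>] t, H u = H t + R t * (u - t)
  left : ∀ t ∈ Set.Ioc 0 L, ∀ᶠ u in 𝓝[<] t, H u = H t + S t * (u - t)

theorem eq_of_affine_of_affine {a b t v : ℝ} {m n : ℝ} (hv : v < t)
    (h : ∀ u ∈ Set.Ioo v t, a + m * u = b + n * (u - t)) : n = m ∧ b = a + m * t := by
  have h1 := h ((v + t) / 2) ⟨by linarith, by linarith⟩
  have h2 := h ((v + 3 * t) / 4) ⟨by linarith, by linarith⟩
  have h3 : (m - n) * (t - v) = 0 := by linarith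
  have h4 : m - n = 0 := by
    rcases mul_eq_zero.mp h3 with h | h
    · exact h
    · linarith
  have h5 : n = m := by linarith
  subst h5
  exact ⟨rfl, by linarith⟩

/-- Continuous induction on the set of `t` such that `H` is affine on `[0, t]`: left slopes make the
set closed, right slopes extend it. -/
theorem HasSlopes.affine_of_no_kink {L : ℝ} (hL : 0 < L) {H : ℝ → ℝ} {R S : ℝ → ℤ}
    (hH : HasSlopes L H R S) (hRS : ∀ t ∈ Set.Ioo 0 L, R t = S t) :
    S L = R 0 ∧ H L = H 0 + R 0 * L := by
  have key : ∀ t ∈ Set.Ioc 0 L, (∀ u ∈ Set.Ico 0 t, H u = H 0 + R 0 * u) →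
      S t = R 0 ∧ H t = H 0 + R 0 * t := by
    intro t ht hu
    obtain ⟨v, hv, hv'⟩ := (mem_nhdsLT_iff_exists_Ioo_subset.mp (hH.left t ht))
    have := eq_of_affine_of_affine (a := H 0) (b := H t) (t := t) (v := max v 0) (m := R 0)
      (n := S t) (max_lt hv ht.1) (by
        intro u hu'
        have h0 : 0 ≤ u := (le_max_right _ _).trans hu'.1.le
        have := hv' ⟨(le_max_left _ _).trans_lt hu'.1, hu'.2⟩
        rw [← hu u ⟨h0, hu'.2⟩]
        exact this)
    exact ⟨by exact_mod_cast this.1, this.2⟩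
  let A : Set ℝ := {t | ∀ u ∈ Set.Icc 0 t, H u = H 0 + R 0 * u}
  have hA : Set.Icc 0 L ⊆ A := by
    refine IsClosed.Icc_subset_of_forall_exists_gt ?_ ?_ ?_
    · refine isClosed_of_closure_subset ?_
      intro t ht
      have htL : t ∈ Set.Icc 0 L := by
        have := closure_mono (Set.inter_subset_right (s := A)) ht
        rwa [isClosed_Icc.closure_eq] at this
      refine ⟨?_, htL⟩
      have hlt : ∀ u ∈ Set.Ico 0 t, H u = H 0 + R 0 * u := by
        intro u hu
        obtain ⟨y, hy, hyA⟩ := mem_closure_iff.mp ht (Set.Ioi u) isOpen_Ioi hu.2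
        exact hyA.1 u ⟨hu.1, le_of_lt hy⟩
      intro u hu
      rcases hu.2.lt_or_eq with h | rfl
      · exact hlt u ⟨hu.1, h⟩
      · rcases hu.1.lt_or_eq with h | h
        · exact (key u ⟨h, htL.2⟩ hlt).2
        · rw [← h]; simp
    · intro u hu
      have : u = 0 := le_antisymm hu.2 hu.1
      simp [this]
    · rintro t ⟨htA, ht⟩ y hy
      have hslope : R t = R 0 := by
        rcases ht.1.lt_or_eq with h | h
        · rw [hRS t ⟨h, ht.2⟩]
          exact (key t ⟨h, ht.2.le⟩ fun u hu => htA u ⟨hu.1, hu.2.le⟩).1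
        · rw [h]
      obtain ⟨v, hv, hv'⟩ := (mem_nhdsGT_iff_exists_Ioo_subset.mp (hH.right t ht))
      have hv0 : t < v := hv
      have hy0 : t < y := hy
      refine ⟨min y ((t + v) / 2), ?_, ?_⟩
      · intro u hu
        rcases le_or_gt u t with h | h
        · exact htA u ⟨hu.1, h⟩
        · have h2 : u ≤ (t + v) / 2 := hu.2.trans (min_le_right _ _)
          have := hv' (show u ∈ Set.Ioo t v from ⟨h, by linarith⟩)
          have h3 := htA t ⟨ht.1, le_rfl⟩
          simp only [Set.mem_ofPred_eq] at this
          rw [this, h3, hslope]; ring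
      · exact ⟨lt_min hy0 (by linarith), min_le_left _ _⟩
  have hLA := hA ⟨hL.le, le_rfl⟩
  exact key L ⟨hL, le_rfl⟩ fun u hu => hLA u ⟨hu.1, hu.2.le⟩

/-- With `o` the jump of the slope at `p`, this removes the kink at `p`; it is the inductive step of
`HasSlopes.integrate`. -/
theorem HasSlopes.sub_kink {L : ℝ} {H : ℝ → ℝ} {R S : ℝ → ℤ} (hH : HasSlopes L H R S)
    (p : ℝ) (o : ℤ) :
    HasSlopes L (fun t => H t - o * max (t - p) 0) (fun t => R t - if p ≤ t then o else 0)
      (fun t => S t - if p < t then o else 0) := by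
  constructor
  · intro t ht
    rcases le_or_gt p t with h | h
    · filter_upwards [hH.right t ht, self_mem_nhdsWithin] with u hu hut
      have : t < u := hut
      rw [hu, if_pos h, max_eq_left (by linarith), max_eq_left (by linarith)]
      push_cast; ring
    · filter_upwards [hH.right t ht, mem_nhdsWithin_of_mem_nhds (Iio_mem_nhds h)] with u hu hut
      have : u < p := hut
      rw [hu, if_neg (by linarith), max_eq_right (by linarith), max_eq_right (by linarith)]
      push_cast; ring
  · intro t ht
    rcases lt_or_ge p t with h | h
    · filter_upwards [hH.left t ht, mem_nhdsWithin_of_mem_nhds (Ioi_mem_nhds h)] with u hu hut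
      have : p < u := hut
      rw [hu, if_pos h, max_eq_left (by linarith), max_eq_left (by linarith)]
      push_cast; ring
    · filter_upwards [hH.left t ht, self_mem_nhdsWithin] with u hu hut
      have : u < t := hut
      rw [hu, if_neg (by linarith), max_eq_right (by linarith), max_eq_right (by linarith)]
      push_cast; ring

/-- The zeroth and first moments of the second derivative, by induction on the number of kinks. -/
theorem HasSlopes.integrate {L : ℝ} (hL : 0 < L) (s : Finset ℝ) (hs : ∀ p ∈ s, p ∈ Set.Ioo 0 L) :
    ∀ {H : ℝ → ℝ} {R S : ℝ → ℤ}, HasSlopes L H R S → (∀ t ∈ Set.Ioo 0 L, t ∉ s → R t = S t) →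
    S L - R 0 = ∑ p ∈ s, (R p - S p) ∧
      H L - H 0 = L * S L - ∑ p ∈ s, p * (R p - S p : ℝ) := by
  induction s using Finset.induction_on with
  | empty =>
    intro H R S hH hRS
    obtain ⟨h1, h2⟩ := hH.affine_of_no_kink hL fun t ht => hRS t ht (by simp)
    rw [h2, h1]
    constructor
    · simp
    · simp; ring
  | insert p s hp ih =>
    intro H R S hH hRS
    have hp0 := hs p (by simp)
    obtain ⟨h1, h2⟩ := ih (fun q hq => hs q (by simp [hq])) (hH.sub_kink p (R p - S p)) (by
      intro t ht hts
      by_cases htp : t = p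
      · subst htp; simp
      · have : p ≤ t ↔ p < t := ⟨fun h => lt_of_le_of_ne h (Ne.symm htp), le_of_lt⟩
        rw [hRS t ht (by simp [htp, hts])]
        simp only [this])
    have hcongr : ∀ q ∈ s, (if p ≤ q then R p - S p else 0) = if p < q then R p - S p else 0 := by
      intro q hq
      have hne : p ≠ q := fun h => hp (h ▸ hq)
      have : p ≤ q ↔ p < q := ⟨fun h => lt_of_le_of_ne h hne, le_of_lt⟩
      simp only [this]
    have hsum1 : ∑ q ∈ s, (R q - (if p ≤ q then R p - S p else 0) -
        (S q - if p < q then R p - S p else 0)) = ∑ q ∈ s, (R q - S q) :=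
      Finset.sum_congr rfl fun q hq => by rw [hcongr q hq]; ring
    have hsum2 : ∑ q ∈ s, q * (((R q - (if p ≤ q then R p - S p else 0) : ℤ) : ℝ) -
        ((S q - if p < q then R p - S p else 0 : ℤ) : ℝ)) = ∑ q ∈ s, q * (R q - S q : ℝ) :=
      Finset.sum_congr rfl fun q hq => by rw [hcongr q hq]; push_cast; ring
    simp only [hsum1, hsum2] at h1 h2
    rw [if_pos hp0.2, if_neg (not_le.mpr hp0.1)] at h1
    rw [if_pos hp0.2, max_eq_left (by linarith [hp0.2]), max_eq_right (by linarith [hp0.1])] at h2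
    rw [Finset.sum_insert hp, Finset.sum_insert hp]
    push_cast at h2
    constructor
    · linarith
    · linarith

end PiecewiseLinear

/-! ### Divisors of edgewise piecewise linear functions. -/

namespace MetricGraph

variable {V E : Type} {Γ : MetricGraph V E}

theorem EdgePL.hasSlopes (F : Γ.EdgePL) (e : E) :
    HasSlopes (Γ.len e) (F.val e) (F.right e) (F.left e) :=
  ⟨F.right_spec e, F.left_spec e⟩

/-- The vertex `v` as a point. -/
def vtx (Γ : MetricGraph V E) (v : V) : Γ.Point := Sum.inl v

/-- An interior point of the edge `e`. -/
def inn (Γ : MetricGraph V E) (e : E) (t : Set.Ioo (0 : ℝ) (Γ.len e)) : Γ.Point := Sum.inr ⟨e, t⟩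

@[elab_as_elim]
theorem Point.cases {motive : Γ.Point → Prop} (vtx : ∀ v, motive (Γ.vtx v))
    (inn : ∀ e t, motive (Γ.inn e t)) (p : Γ.Point) : motive p :=
  match p with
  | Sum.inl v => vtx v
  | Sum.inr ⟨e, t⟩ => inn e t

/-- The function on points given by `φ` on the vertices and by `ψ e` on the edge `e`. -/
def extend (Γ : MetricGraph V E) {α : Type*} (φ : V → α) (ψ : E → ℝ → α) : Γ.Point → α :=
  Sum.elim φ fun q => ψ q.1 q.2

@[simp]
theorem extend_vtx {α : Type*} (φ : V → α) (ψ : E → ℝ → α) (v : V) :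
    Γ.extend φ ψ (Γ.vtx v) = φ v := rfl

@[simp]
theorem extend_inn {α : Type*} (φ : V → α) (ψ : E → ℝ → α) (e : E)
    (t : Set.Ioo (0 : ℝ) (Γ.len e)) : Γ.extend φ ψ (Γ.inn e t) = ψ e t := rfl

@[simp]
theorem vtx_inj {v v' : V} : Γ.vtx v = Γ.vtx v' ↔ v = v' := Sum.inl_injective.eq_iff

@[simp]
theorem vtx_ne_inn (v : V) (e : E) (t : Set.Ioo (0 : ℝ) (Γ.len e)) : Γ.vtx v ≠ Γ.inn e t :=
  Sum.inl_ne_inr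

@[simp]
theorem inn_ne_vtx (v : V) (e : E) (t : Set.Ioo (0 : ℝ) (Γ.len e)) : Γ.inn e t ≠ Γ.vtx v :=
  Sum.inr_ne_inl

theorem inn_inj {e e' : E} {t : Set.Ioo (0 : ℝ) (Γ.len e)} {t' : Set.Ioo (0 : ℝ) (Γ.len e')} :
    Γ.inn e t = Γ.inn e' t' ↔ e = e' ∧ (t : ℝ) = t' := by
  constructor
  · intro h
    have h2 := Sum.inr_injective h
    cases h2
    exact ⟨rfl, rfl⟩
  · rintro ⟨rfl, h⟩
    rw [Subtype.ext h]

open Classical in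
theorem EdgePL.ord_vtx [Fintype E] (F : Γ.EdgePL) (v : V) : F.ord (Γ.vtx v) =
    (∑ e, if Γ.src e = v then F.right e 0 else 0) -
      ∑ e, if Γ.tgt e = v then F.left e (Γ.len e) else 0 := rfl

theorem EdgePL.ord_inn [Fintype E] (F : Γ.EdgePL) (e : E) (t : Set.Ioo (0 : ℝ) (Γ.len e)) :
    F.ord (Γ.inn e t) = F.right e t - F.left e t := rfl

open Classical in
/-- Integration by parts against a function that is affine on each edge. -/
theorem EdgePL.sum_ord [Fintype V] [Fintype E] (F : Γ.EdgePL) (D : Γ.Divisor)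
    (hD : ∀ p, D p = F.ord p) (φ : V → ℝ) (α β : E → ℝ) :
    (D.sum fun p n => n • Γ.extend φ (fun e t => α e + β e * t) p) =
      ∑ e, ((φ (Γ.src e) - α e) * F.right e 0 + (α e + β e * Γ.len e - φ (Γ.tgt e)) *
        F.left e (Γ.len e) - β e * (F.val e (Γ.len e) - F.val e 0)) := by
  let s : ∀ e, Finset (Set.Ioo (0 : ℝ) (Γ.len e)) := fun e =>
    D.support.preimage (Γ.inn e) (fun a _ b _ h => Subtype.ext (inn_inj.mp h).2)
  have hs : ∀ e t, t ∈ s e ↔ D (Γ.inn e t) ≠ 0 := fun e t =>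
    Finset.mem_preimage.trans Finsupp.mem_support_iff
  let ψ : Γ.Point → ℝ := Γ.extend φ (fun e t => α e + β e * t)
  let U₁ : Finset Γ.Point := Finset.univ.map ⟨Γ.vtx, fun a b h => vtx_inj.mp h⟩
  let U₂ : Finset Γ.Point := (Finset.univ.sigma s).map ⟨fun q => Γ.inn q.1 q.2, by
    rintro ⟨e, t⟩ ⟨e', t'⟩ h
    obtain ⟨h1, h2⟩ := inn_inj.mp h
    dsimp only at h1
    subst h1
    have h3 : t = t' := Subtype.ext h2
    rw [h3]⟩
  have hdisj : Disjoint U₁ U₂ := by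
    rw [Finset.disjoint_left]
    intro p hp hp'
    obtain ⟨v, -, rfl⟩ := Finset.mem_map.mp hp
    obtain ⟨q, -, hq⟩ := Finset.mem_map.mp hp'
    exact inn_ne_vtx _ _ _ hq
  have h0 : (D.sum fun p n => n • ψ p) = ∑ p ∈ U₁ ∪ U₂, F.ord p • ψ p := by
    rw [Finsupp.sum]
    simp only [hD]
    refine Finset.sum_subset ?_ ?_
    · intro p hp
      rw [Finset.mem_union]
      induction p using Point.cases with
      | vtx v => exact Or.inl (Finset.mem_map.mpr ⟨v, by simp, rfl⟩)
      | inn e t =>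
        refine Or.inr (Finset.mem_map.mpr ⟨⟨e, t⟩, ?_, rfl⟩)
        simpa [hs] using hp
    · intro p _ hp
      rw [← hD, Finsupp.notMem_support_iff.mp hp, zero_smul]
  -- On a single edge only the two moments from `HasSlopes.integrate` enter, since the test function
  -- is affine there.
  have hint : ∀ e, ∑ t ∈ s e, F.ord (Γ.inn e t) • (α e + β e * (t : ℝ)) =
      α e * (F.left e (Γ.len e) - F.right e 0) +
        β e * (Γ.len e * F.left e (Γ.len e) - (F.val e (Γ.len e) - F.val e 0)) := by
    intro e
    obtain ⟨h1, h2⟩ := (F.hasSlopes e).integrate (Γ.len_pos e)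
      ((s e).map (Function.Embedding.subtype _)) (by
        intro p hp
        obtain ⟨q, -, rfl⟩ := Finset.mem_map.mp hp
        exact q.2) (by
        intro t ht hts
        by_contra hne
        refine hts (Finset.mem_map.mpr ⟨⟨t, ht⟩, ?_, rfl⟩)
        rw [hs, hD]
        exact sub_ne_zero.mpr hne)
    rw [Finset.sum_map] at h1 h2
    have h1' : (F.left e (Γ.len e) - F.right e 0 : ℝ) =
        ∑ t ∈ s e, (F.right e t - F.left e t : ℝ) := by
      exact_mod_cast h1
    rw [h1', Finset.mul_sum]
    have h2' : Γ.len e * F.left e (Γ.len e) - (F.val e (Γ.len e) - F.val e 0) =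
        ∑ t ∈ s e, (t : ℝ) * (F.right e t - F.left e t : ℝ) := by
      rw [h2]; simp
    rw [h2', Finset.mul_sum, ← Finset.sum_add_distrib]
    refine Finset.sum_congr rfl fun t _ => ?_
    simp only [EdgePL.ord_inn, zsmul_eq_mul]
    push_cast
    ring
  change (D.sum fun p n => n • ψ p) = _
  rw [h0, Finset.sum_union hdisj, Finset.sum_map, Finset.sum_map, Finset.sum_sigma]
  have hv : ∑ v, F.ord (Γ.vtx v) • ψ (Γ.vtx v) =
      ∑ e, (φ (Γ.src e) * F.right e 0 - φ (Γ.tgt e) * F.left e (Γ.len e)) := by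
    simp only [EdgePL.ord_vtx, ψ, extend_vtx, zsmul_eq_mul]
    push_cast
    simp only [sub_mul, Finset.sum_sub_distrib, Finset.sum_mul]
    congr 1
    · rw [Finset.sum_comm]
      refine Finset.sum_congr rfl fun e _ => ?_
      simp [mul_comm]
    · rw [Finset.sum_comm]
      refine Finset.sum_congr rfl fun e _ => ?_
      simp [mul_comm]
  have he : ∑ e, ∑ t ∈ s e, F.ord (Γ.inn e t) • ψ (Γ.inn e t) =
      ∑ e, (α e * (F.left e (Γ.len e) - F.right e 0) +
        β e * (Γ.len e * F.left e (Γ.len e) - (F.val e (Γ.len e) - F.val e 0))) :=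
    Finset.sum_congr rfl fun e _ => hint e
  refine (congrArg₂ (· + ·) hv he).trans ?_
  rw [← Finset.sum_add_distrib]
  refine Finset.sum_congr rfl fun e _ => ?_
  ring

/-- The pairs formed by the divisor of an edgewise piecewise linear function and its increments
along the edges. -/
def ordIncrement [Fintype E] (Γ : MetricGraph V E) : AddSubgroup (Γ.Divisor × (E → ℝ)) where
  carrier := {x | ∃ F : Γ.EdgePL, (∀ p, x.1 p = F.ord p) ∧
    ∀ e, x.2 e = F.val e (Γ.len e) - F.val e 0}
  zero_mem' := by
    refine ⟨⟨0, 0, 0, by simp, by simp⟩, ?_, by simp⟩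
    intro p
    rw [Prod.fst_zero, Finsupp.zero_apply]
    rcases p with v | ⟨e, t⟩ <;> simp [EdgePL.ord]
  add_mem' := by
    rintro x y ⟨F, hF, hF'⟩ ⟨G, hG, hG'⟩
    refine ⟨⟨F.val + G.val, F.right + G.right, F.left + G.left, ?_, ?_⟩, ?_, ?_⟩
    · intro e t ht
      filter_upwards [F.right_spec e t ht, G.right_spec e t ht] with u h h'
      simp only [Pi.add_apply, h, h', Int.cast_add]
      ring
    · intro e t ht
      filter_upwards [F.left_spec e t ht, G.left_spec e t ht] with u h h'
      simp only [Pi.add_apply, h, h', Int.cast_add]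
      ring
    · intro p
      rw [Prod.fst_add, Finsupp.add_apply, hF, hG]
      rcases p with v | ⟨e, t⟩
      · simp only [EdgePL.ord, Pi.add_apply, ← Finset.sum_filter, Finset.sum_add_distrib]
        ring
      · simp only [EdgePL.ord, Pi.add_apply]
        ring
    · intro e
      simp only [Prod.snd_add, Pi.add_apply, hF', hG']
      ring
  neg_mem' := by
    rintro x ⟨F, hF, hF'⟩
    refine ⟨⟨-F.val, -F.right, -F.left, ?_, ?_⟩, ?_, ?_⟩
    · intro e t ht
      filter_upwards [F.right_spec e t ht] with u h
      simp only [Pi.neg_apply, h, Int.cast_neg]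
      ring
    · intro e t ht
      filter_upwards [F.left_spec e t ht] with u h
      simp only [Pi.neg_apply, h, Int.cast_neg]
      ring
    · intro p
      rw [Prod.fst_neg, Finsupp.neg_apply, hF]
      rcases p with v | ⟨e, t⟩
      · simp only [EdgePL.ord, Pi.neg_apply, ← Finset.sum_filter, Finset.sum_neg_distrib]
        ring
      · simp only [EdgePL.ord, Pi.neg_apply]
        ring
    · intro e
      simp only [Prod.snd_neg, Pi.neg_apply, hF']
      ring

theorem pt_of_nonpos (e : E) {t : ℝ} (ht : t ≤ 0) : Γ.pt e t = Γ.vtx (Γ.src e) := by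
  exact (dif_neg (fun h => absurd h.1 (not_lt.mpr ht))).trans (if_pos ht)

theorem pt_of_mem_Ioo (e : E) {t : ℝ} (ht : t ∈ Set.Ioo 0 (Γ.len e)) :
    Γ.pt e t = Γ.inn e ⟨t, ht⟩ := by
  exact dif_pos ht

theorem pt_len (e : E) : Γ.pt e (Γ.len e) = Γ.vtx (Γ.tgt e) := by
  exact (dif_neg (fun h => lt_irrefl _ h.2)).trans (if_neg (not_le.mpr (Γ.len_pos e)))

/-- Witnessed by `min u t` on `e` and `0` on all other edges: slope 1 leaves the start of `e` and
stops at distance `t`. -/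
theorem single_sub_single_mem_ordIncrement [Fintype E] [DecidableEq E] (e : E) {t : ℝ}
    (ht : t ∈ Set.Icc 0 (Γ.len e)) :
    ((Finsupp.single (Γ.vtx (Γ.src e)) 1 - Finsupp.single (Γ.pt e t) 1 : Γ.Divisor),
      Pi.single e t) ∈ Γ.ordIncrement := by
  classical
  have hr : ∀ e', ∀ u ∈ Set.Ico 0 (Γ.len e'), ∀ᶠ x in 𝓝[>] u, (if e' = e then min x t else 0) =
      (if e' = e then min u t else 0) +
        ((if e' = e then (if u < t then 1 else 0) else 0 : ℤ) : ℝ) * (x - u) := by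
    intro e' u hu
    split_ifs with h1 h2
    · filter_upwards [mem_nhdsWithin_of_mem_nhds (Iio_mem_nhds h2)] with x hx
      rw [min_eq_left (le_of_lt hx), min_eq_left h2.le]; simp
    · filter_upwards [self_mem_nhdsWithin] with x hx
      have : u < x := hx
      rw [min_eq_right (by linarith), min_eq_right (by linarith)]; simp
    · simp
  have hl : ∀ e', ∀ u ∈ Set.Ioc 0 (Γ.len e'), ∀ᶠ x in 𝓝[<] u, (if e' = e then min x t else 0) =
      (if e' = e then min u t else 0) +
        ((if e' = e then (if u ≤ t then 1 else 0) else 0 : ℤ) : ℝ) * (x - u) := by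
    intro e' u hu
    split_ifs with h1 h2
    · filter_upwards [self_mem_nhdsWithin] with x hx
      have : x < u := hx
      rw [min_eq_left (by linarith), min_eq_left (by linarith)]; simp
    · filter_upwards [mem_nhdsWithin_of_mem_nhds (Ioi_mem_nhds (not_le.mp h2))] with x hx
      have : t < x := hx
      rw [min_eq_right (by linarith), min_eq_right (by linarith)]; simp
    · simp
  refine ⟨⟨fun e' u => if e' = e then min u t else 0,
    fun e' u => if e' = e then (if u < t then 1 else 0) else 0,
    fun e' u => if e' = e then (if u ≤ t then 1 else 0) else 0, hr, hl⟩, ?_, ?_⟩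
  · have hlen := Γ.len_pos e
    intro p
    induction p using Point.cases with
    | vtx v =>
      have h1 : (∑ e', if Γ.src e' = v then (if e' = e then (if (0 : ℝ) < t then (1 : ℤ) else 0)
          else 0) else 0) = if Γ.src e = v then (if (0 : ℝ) < t then (1 : ℤ) else 0) else 0 := by
        rw [Finset.sum_eq_single e]
        · simp
        · intro b _ hb; simp [hb]
        · simp
      have h2 : (∑ e', if Γ.tgt e' = v then (if e' = e then (if Γ.len e' ≤ t then (1 : ℤ) else 0)
          else 0) else 0) = if Γ.tgt e = v then (if Γ.len e ≤ t then (1 : ℤ) else 0) else 0 := by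
        rw [Finset.sum_eq_single e]
        · simp
        · intro b _ hb; simp [hb]
        · simp
      simp only [EdgePL.ord_vtx, h1, h2]
      rcases ht.1.eq_or_lt with h | h
      · subst h
        rw [pt_of_nonpos e le_rfl]
        simp [hlen]
      · rcases ht.2.eq_or_lt with h' | h'
        · subst h'
          rw [pt_len]
          simp [hlen, Finsupp.single_apply]
        · rw [pt_of_mem_Ioo e ⟨h, h'⟩]
          simp [h, h'.not_ge, Finsupp.single_apply]
    | inn e' u =>
      have hR : (EdgePL.ord (Γ := Γ) ⟨fun e' u => if e' = e then min u t else 0,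
          fun e' u => if e' = e then (if u < t then 1 else 0) else 0,
          fun e' u => if e' = e then (if u ≤ t then 1 else 0) else 0, hr, hl⟩ (Γ.inn e' u)) = if e' = e ∧ (u : ℝ) = t then -1 else 0 := by
        simp only [EdgePL.ord_inn]
        by_cases he : e' = e
        · rcases lt_trichotomy (u : ℝ) t with h | h | h
          · simp [he, h, h.le, h.ne]
          · simp [he, h]
          · simp [he, h.not_gt, h.not_ge, h.ne']
        · simp [he]
      rw [hR]
      rcases ht.1.eq_or_lt with h | h
      · subst h
        rw [pt_of_nonpos e le_rfl]
        have : ¬ (e' = e ∧ (u : ℝ) = 0) := fun h => (u.2.1.ne' h.2)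
        simp [this]
      · rcases ht.2.eq_or_lt with h' | h'
        · subst h'
          rw [pt_len]
          have : ¬ (e' = e ∧ (u : ℝ) = Γ.len e) := by
            rintro ⟨rfl, h⟩
            exact u.2.2.ne h
          rw [if_neg this]
          simp
        · rw [pt_of_mem_Ioo e ⟨h, h'⟩]
          by_cases hc : e' = e ∧ (u : ℝ) = t
          · obtain ⟨rfl, rfl⟩ := hc
            simp
          · rw [if_neg hc]
            have : Γ.inn e ⟨t, ⟨h, h'⟩⟩ ≠ Γ.inn e' u :=
              fun h => hc ⟨(inn_inj.mp h).1.symm, (inn_inj.mp h).2.symm⟩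
            simp [this]
  · intro e'
    by_cases he : e' = e
    · subst he
      simp [ht.1, ht.2]
    · simp [he]

/-- Adding a constant on each edge does not change slopes. When the increments come from a
potential, the constants can be chosen so that the pieces glue at the vertices. -/
theorem mem_principal_of_potential [Fintype E] {D : Γ.Divisor} {δ : E → ℝ}
    (h : (D, δ) ∈ Γ.ordIncrement) (f : V → ℝ) (hf : ∀ e, δ e = f (Γ.tgt e) - f (Γ.src e)) :
    D ∈ Γ.principal := by
  obtain ⟨F, hF, hF'⟩ := h
  refine ⟨Γ.extend f fun e u => F.val e u - F.val e 0 + f (Γ.src e),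
    ⟨fun e u => F.val e u - F.val e 0 + f (Γ.src e), F.right, F.left, ?_, ?_⟩, ?_, hF⟩
  · intro e t ht
    filter_upwards [F.right_spec e t ht] with u hu
    rw [hu]; ring
  · intro e t ht
    filter_upwards [F.left_spec e t ht] with u hu
    rw [hu]; ring
  · intro e t ht
    rcases ht.1.eq_or_lt with h | h
    · subst h
      rw [pt_of_nonpos e le_rfl]
      simp
    · rcases ht.2.eq_or_lt with h' | h'
      · subst h'
        rw [pt_len]
        have h1 := hF' e
        have h2 := hf e
        simp only [extend_vtx] at h1 ⊢
        linarith
      · rw [pt_of_mem_Ioo e ⟨h, h'⟩]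
        simp

theorem exists_mem_ordIncrement_of_mem_principal [Fintype E] {D : Γ.Divisor}
    (h : D ∈ Γ.principal) :
    ∃ f : V → ℝ, (D, fun e => f (Γ.tgt e) - f (Γ.src e)) ∈ Γ.ordIncrement := by
  obtain ⟨f, F, hF, hD⟩ := h
  refine ⟨fun v => f (Γ.vtx v), F, hD, fun e => ?_⟩
  have hlen := Γ.len_pos e
  rw [hF e _ ⟨hlen.le, le_rfl⟩, hF e 0 ⟨le_rfl, hlen.le⟩, pt_len, pt_of_nonpos e le_rfl]

end MetricGraph

end Tropical

/-! ### Abel–Jacobi coordinates on a chain of cycles. -/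

namespace Tropical

namespace MetricGraph

variable {V E : Type} {Γ : MetricGraph V E}

/-- The degree as a homomorphism. -/
noncomputable def degreeHom (Γ : MetricGraph V E) : Γ.Divisor →+ ℤ :=
  Finsupp.liftAddHom fun _ => AddMonoidHom.id ℤ

theorem degreeHom_apply (D : Γ.Divisor) : Γ.degreeHom D = degree D := rfl

@[simp]
theorem degreeHom_single (p : Γ.Point) (n : ℤ) : Γ.degreeHom (Finsupp.single p n) = n := by
  simp [degreeHom]

/-- Integration by parts against the constant function 1. -/
theorem degree_eq_zero_of_mem_ordIncrement [Finite V] [Fintype E] {D : Γ.Divisor} {δ : E → ℝ}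
    (h : (D, δ) ∈ Γ.ordIncrement) : Γ.degreeHom D = 0 := by
  have := Fintype.ofFinite V
  obtain ⟨F, hF, -⟩ := h
  have := F.sum_ord D hF (fun _ => 1) (fun _ => 1) (fun _ => 0)
  have h1 : Γ.extend (fun _ => (1 : ℝ)) (fun e t => 1 + 0 * t) = fun _ => 1 := by
    funext p
    induction p using Point.cases <;> simp
  rw [h1] at this
  have h2 : ((Γ.degreeHom D : ℤ) : ℝ) = D.sum fun _ n => n • (1 : ℝ) := by
    rw [degreeHom_apply, degree, Finsupp.sum, Finsupp.sum]
    push_cast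
    simp
  have h3 : ((Γ.degreeHom D : ℤ) : ℝ) = 0 := by
    rw [h2, this]
    simp
  exact_mod_cast h3

theorem single_vtx_sub_single_vtx_mem [Fintype E] (e : E) :
    Finsupp.single (Γ.vtx (Γ.src e)) 1 - Finsupp.single (Γ.vtx (Γ.tgt e)) 1 ∈
      Γ.ordIncrement.map (AddMonoidHom.fst _ _) := by
  classical
  have := single_sub_single_mem_ordIncrement (Γ := Γ) e (t := Γ.len e) ⟨(Γ.len_pos e).le, le_rfl⟩
  rw [pt_len] at this
  exact ⟨_, this, rfl⟩

theorem single_vtx_sub_single_inn_mem [Fintype E] (e : E) (t : Set.Ioo (0 : ℝ) (Γ.len e)) :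
    Finsupp.single (Γ.vtx (Γ.src e)) 1 - Finsupp.single (Γ.inn e t) 1 ∈
      Γ.ordIncrement.map (AddMonoidHom.fst _ _) := by
  classical
  have := single_sub_single_mem_ordIncrement (Γ := Γ) e (t := t) ⟨t.2.1.le, t.2.2.le⟩
  rw [pt_of_mem_Ioo e t.2] at this
  exact ⟨_, this, rfl⟩

end MetricGraph

namespace ChainOfCycles

open MetricGraph

variable {g : ℕ} (C : ChainOfCycles g)

theorem cycleLength_pos (i : Fin g) : 0 < C.cycleLength i := add_pos (C.arc_pos i) (C.coarc_pos i)

theorem merged_succ {k : Fin (g - 1)} :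
    C.Merged ⟨(k : ℕ) + 1, by omega⟩ ↔ C.bridge k = 0 := by
  constructor
  · rintro ⟨k', h, h'⟩
    have : k' = k := Fin.ext (by simpa using h)
    rwa [← this]
  · intro h
    exact ⟨k, rfl, h⟩

theorem v_succ_of_bridge_eq_zero {k : Fin (g - 1)} (h : C.bridge k = 0) :
    C.v ⟨(k : ℕ) + 1, by omega⟩ = C.w ⟨k, by omega⟩ := by
  rw [v, dif_pos (C.merged_succ.mpr h)]
  rfl

theorem v_of_not_merged {i : Fin g} (h : ¬ C.Merged i) : C.v i = Sum.inr ⟨i, h⟩ := by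
  rw [v, dif_neg h]

/-- The function on the vertices with value `φw i` at `w i` and `φv i` at `v i`. -/
def vertexFun {α : Type*} (φw φv : Fin g → α) : C.Vertex → α := Sum.elim φw fun i => φv i.1

@[simp]
theorem vertexFun_w {α : Type*} (φw φv : Fin g → α) (i : Fin g) :
    C.vertexFun φw φv (C.w i) = φw i := rfl

/-- The hypothesis is well-definedness: `w k` and `v (k + 1)` are one vertex when the bridge has
length 0. -/
theorem vertexFun_v {α : Type*} (φw φv : Fin g → α)
    (h : ∀ k : Fin (g - 1), C.bridge k = 0 → φw ⟨k, by omega⟩ = φv ⟨(k : ℕ) + 1, by omega⟩)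
    (i : Fin g) : C.vertexFun φw φv (C.v i) = φv i := by
  by_cases hi : C.Merged i
  · obtain ⟨k, hk, hk'⟩ := hi
    have : i = ⟨(k : ℕ) + 1, by omega⟩ := Fin.ext hk.symm
    rw [this, C.v_succ_of_bridge_eq_zero hk', vertexFun_w, h k hk']
  · rw [C.v_of_not_merged hi]
    rfl

theorem forall_vertex {P : C.Vertex → Prop} (hv : ∀ i, P (C.v i)) (hw : ∀ i, P (C.w i))
    (x : C.Vertex) : P x := by
  rcases x with i | i
  · exact hw i
  · rw [← C.v_of_not_merged i.2]
    exact hv i.1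

/-- The edge from `v i` to `w i`. -/
abbrev arcEdge (i : Fin g) : C.Edge := Sum.inl i

/-- The edge from `w i` to `v i`. -/
abbrev coarcEdge (i : Fin g) : C.Edge := Sum.inr (Sum.inl i)

/-- The position, clockwise from `v i`, of the projection of a vertex to the cycle `i`. -/
def posVertex (i : Fin g) : C.Vertex → ℝ :=
  C.vertexFun (fun j => if j < i then 0 else C.arc i) (fun j => if j ≤ i then 0 else C.arc i)

theorem posVertex_w (i j : Fin g) : C.posVertex i (C.w j) = if j < i then 0 else C.arc i := rfl

theorem posVertex_v (i j : Fin g) : C.posVertex i (C.v j) = if j ≤ i then 0 else C.arc i := by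
  refine C.vertexFun_v _ _ (fun k _ => ?_) j
  simp only [Fin.lt_def, Fin.le_def, Nat.succ_le_iff]

/-- The position on the cycle `i` of the projection of the start of an edge. -/
def posStart (i : Fin g) : C.Edge → ℝ
  | Sum.inl j => if j ≤ i then 0 else C.arc i
  | Sum.inr (Sum.inl j) => if j < i then 0 else C.arc i
  | Sum.inr (Sum.inr k) => if (k.1 : ℕ) < i then 0 else C.arc i

/-- The speed of the projection of an edge to the cycle `i`. -/
def posSpeed (i : Fin g) : C.Edge → ℝ
  | Sum.inl j => if j = i then 1 else 0
  | Sum.inr (Sum.inl j) => if j = i then 1 else 0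
  | Sum.inr (Sum.inr _) => 0

/-- The position, clockwise from `v i`, of the projection of a point to the cycle `i`. -/
noncomputable def pos (i : Fin g) : C.graph.Point → ℝ :=
  C.graph.extend (C.posVertex i) fun e t => C.posStart i e + C.posSpeed i e * t

/-- The component of the Abel--Jacobi map at the cycle `i`. -/
noncomputable def coord (i : Fin g) : C.graph.Divisor →+ AddCircle (C.cycleLength i) :=
  (QuotientAddGroup.mk' _).comp (Finsupp.linearCombination ℤ (C.pos i)).toAddMonoidHom

theorem coord_apply (i : Fin g) (D : C.graph.Divisor) :
    C.coord i D = ((D.sum fun p n => n • C.pos i p : ℝ) : AddCircle (C.cycleLength i)) := rfl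

@[simp]
theorem coord_single (i : Fin g) (p : C.graph.Point) (n : ℤ) :
    C.coord i (Finsupp.single p n) = n • (C.pos i p : AddCircle (C.cycleLength i)) := by
  rw [coord_apply, Finsupp.sum_single_index (by simp)]
  rfl

/-- Integrate by parts against `pos i`. This function is continuous except at the end of `coarcEdge
i`, where it drops from the length of the cycle to 0. The only boundary term is therefore an integer
slope times the period, which vanishes in the circle. -/
theorem coord_eq_of_mem_ordIncrement {D : C.graph.Divisor} {δ : C.Edge → ℝ}
    (h : (D, δ) ∈ C.graph.ordIncrement) (i : Fin g) :
    C.coord i D = -((δ (C.arcEdge i) + δ (C.coarcEdge i) : ℝ) : AddCircle (C.cycleLength i)) := by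
  classical
  obtain ⟨F, hF, hδ⟩ := h
  have key := F.sum_ord D hF (C.posVertex i) (C.posStart i) (C.posSpeed i)
  have harc : ∀ j, ((C.posVertex i (C.graph.src (C.arcEdge j)) - C.posStart i (C.arcEdge j)) *
      F.right (C.arcEdge j) 0 + (C.posStart i (C.arcEdge j) +
        C.posSpeed i (C.arcEdge j) * C.graph.len (C.arcEdge j) -
        C.posVertex i (C.graph.tgt (C.arcEdge j))) *
      F.left (C.arcEdge j) (C.graph.len (C.arcEdge j)) - C.posSpeed i (C.arcEdge j) *
      (F.val (C.arcEdge j) (C.graph.len (C.arcEdge j)) - F.val (C.arcEdge j) 0) : ℝ) =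
        if j = i then - δ (C.arcEdge i) else 0 := by
    intro j
    rw [← hδ, show C.graph.src (C.arcEdge j) = C.v j from rfl,
      show C.graph.tgt (C.arcEdge j) = C.w j from rfl,
      show C.graph.len (C.arcEdge j) = C.arc j from rfl, posVertex_v, posVertex_w, posStart,
      posSpeed]
    rcases lt_trichotomy j i with h | h | h
    · simp [h, h.le, h.ne]
    · subst h; simp
    · simp [h.not_gt, h.not_ge, h.ne']
  have hcoarc : ∀ j, ((C.posVertex i (C.graph.src (C.coarcEdge j)) - C.posStart i (C.coarcEdge j)) *
      F.right (C.coarcEdge j) 0 + (C.posStart i (C.coarcEdge j) +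
        C.posSpeed i (C.coarcEdge j) * C.graph.len (C.coarcEdge j) -
        C.posVertex i (C.graph.tgt (C.coarcEdge j))) *
      F.left (C.coarcEdge j) (C.graph.len (C.coarcEdge j)) - C.posSpeed i (C.coarcEdge j) *
      (F.val (C.coarcEdge j) (C.graph.len (C.coarcEdge j)) - F.val (C.coarcEdge j) 0) : ℝ) =
        if j = i then C.cycleLength i * F.left (C.coarcEdge i) (C.graph.len (C.coarcEdge i))
          - δ (C.coarcEdge i) else 0 := by
    intro j
    rw [← hδ, show C.graph.src (C.coarcEdge j) = C.w j from rfl,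
      show C.graph.tgt (C.coarcEdge j) = C.v j from rfl,
      show C.graph.len (C.coarcEdge j) = C.coarc j from rfl, posVertex_v, posVertex_w, posStart,
      posSpeed]
    rcases lt_trichotomy j i with h | h | h
    · simp [h, h.le, h.ne]
    · subst h; simp only [le_refl, if_true, lt_irrefl, if_false, cycleLength, sub_self, zero_mul, one_mul,
        zero_add, sub_zero]
      rfl
    · simp [h.not_gt, h.not_ge, h.ne']
  have hbridge : ∀ k, ((C.posVertex i (C.graph.src (Sum.inr (Sum.inr k))) -
        C.posStart i (Sum.inr (Sum.inr k))) *
      F.right (Sum.inr (Sum.inr k)) 0 + (C.posStart i (Sum.inr (Sum.inr k)) +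
        C.posSpeed i (Sum.inr (Sum.inr k)) * C.graph.len (Sum.inr (Sum.inr k)) -
        C.posVertex i (C.graph.tgt (Sum.inr (Sum.inr k)))) *
      F.left (Sum.inr (Sum.inr k)) (C.graph.len (Sum.inr (Sum.inr k))) -
        C.posSpeed i (Sum.inr (Sum.inr k)) *
      (F.val (Sum.inr (Sum.inr k)) (C.graph.len (Sum.inr (Sum.inr k))) -
        F.val (Sum.inr (Sum.inr k)) 0) : ℝ) = 0 := by
    intro k
    rw [show C.graph.src (Sum.inr (Sum.inr k)) = C.w ⟨k.1, by omega⟩ from rfl,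
      show C.graph.tgt (Sum.inr (Sum.inr k)) = C.v ⟨(k.1 : ℕ) + 1, by omega⟩ from rfl,
      posVertex_v, posVertex_w, posStart, posSpeed]
    simp [Fin.lt_def, Fin.le_def]
  rw [Fintype.sum_sum_type, Fintype.sum_sum_type, Finset.sum_congr rfl fun j _ => harc j,
    Finset.sum_congr rfl fun j _ => hcoarc j, Finset.sum_congr rfl fun k _ => hbridge k] at key
  simp only [Finset.sum_ite_eq', Finset.mem_univ, if_true, Finset.sum_const_zero, add_zero] at key
  rw [coord_apply]
  have key' : (D.sum fun p n => n • C.pos i p) = - (δ (C.arcEdge i) + δ (C.coarcEdge i)) +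
      F.left (C.coarcEdge i) (C.graph.len (C.coarcEdge i)) • C.cycleLength i := by
    refine Eq.trans key ?_
    rw [zsmul_eq_mul]
    ring
  rw [key', AddCircle.coe_add, AddCircle.coe_zsmul, AddCircle.coe_period, smul_zero, add_zero,
    AddCircle.coe_neg]

theorem single_vtx_sub_single_base_mem (hg : 0 < g) (x : C.Vertex) :
    Finsupp.single (C.graph.vtx x) 1 - Finsupp.single (C.graph.vtx (C.v ⟨0, hg⟩)) 1 ∈
      C.graph.ordIncrement.map (AddMonoidHom.fst _ _) := by
  set K := C.graph.ordIncrement.map (AddMonoidHom.fst _ _)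
  have hw : ∀ i, Finsupp.single (C.graph.vtx (C.v i)) 1 -
      Finsupp.single (C.graph.vtx (C.w i)) 1 ∈ K := fun i =>
    single_vtx_sub_single_vtx_mem (Γ := C.graph) (C.arcEdge i)
  have hstep : ∀ i, Finsupp.single (C.graph.vtx (C.v i)) 1 -
        Finsupp.single (C.graph.vtx (C.v ⟨0, hg⟩)) 1 ∈ K →
      Finsupp.single (C.graph.vtx (C.w i)) 1 -
        Finsupp.single (C.graph.vtx (C.v ⟨0, hg⟩)) 1 ∈ K := fun i h => by
    have := K.sub_mem h (hw i)
    rwa [sub_sub_sub_cancel_left] at this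
  have hv : ∀ n (hn : n < g), Finsupp.single (C.graph.vtx (C.v ⟨n, hn⟩)) 1 -
      Finsupp.single (C.graph.vtx (C.v ⟨0, hg⟩)) 1 ∈ K := by
    intro n
    induction n with
    | zero => intro _; rw [sub_self]; exact K.zero_mem
    | succ n ih =>
      intro hn
      have h := hstep _ (ih (by omega))
      rcases (C.bridge_nonneg ⟨n, by omega⟩).eq_or_lt with h0 | h0
      · rw [C.v_succ_of_bridge_eq_zero (k := ⟨n, by omega⟩) h0.symm]
        exact h
      · have h1 : Finsupp.single (C.graph.vtx (C.w ⟨n, by omega⟩)) 1 -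
            Finsupp.single (C.graph.vtx (C.v ⟨n + 1, by omega⟩)) 1 ∈ K :=
          single_vtx_sub_single_vtx_mem (Γ := C.graph) (Sum.inr (Sum.inr ⟨⟨n, by omega⟩, h0⟩))
        have := K.sub_mem h h1
        rwa [sub_sub_sub_cancel_left] at this
  exact C.forall_vertex (P := fun x => Finsupp.single (C.graph.vtx x) 1 -
    Finsupp.single (C.graph.vtx (C.v ⟨0, hg⟩)) 1 ∈ K)
    (fun i => hv i i.2) (fun i => hstep i (hv i i.2)) x

theorem single_sub_single_base_mem (hg : 0 < g) (p : C.graph.Point) :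
    Finsupp.single p 1 - Finsupp.single (C.graph.vtx (C.v ⟨0, hg⟩)) 1 ∈
      C.graph.ordIncrement.map (AddMonoidHom.fst _ _) := by
  induction p using Point.cases with
  | vtx x => exact C.single_vtx_sub_single_base_mem hg x
  | inn e t =>
    have := AddSubgroup.sub_mem _ (C.single_vtx_sub_single_base_mem hg (C.graph.src e))
      (single_vtx_sub_single_inn_mem e t)
    rwa [sub_sub_sub_cancel_left] at this

theorem exists_mem_ordIncrement (hg : 0 < g) {D : C.graph.Divisor} (hD : C.graph.degreeHom D = 0) :
    ∃ δ, (D, δ) ∈ C.graph.ordIncrement := by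
  let b := C.graph.vtx (C.v ⟨0, hg⟩)
  have h : ∀ D : C.graph.Divisor, D - Finsupp.single b (C.graph.degreeHom D) ∈
      C.graph.ordIncrement.map (AddMonoidHom.fst _ _) := by
    intro D
    induction D using Finsupp.induction_linear with
    | zero => simp
    | add D D' h h' =>
      have := AddSubgroup.add_mem _ h h'
      rw [map_add, Finsupp.single_add]
      convert this using 1
      abel
    | single p n =>
      have := AddSubgroup.zsmul_mem _ (C.single_sub_single_base_mem hg p) n
      rw [degreeHom_single]
      convert this using 1
      rw [smul_sub, Finsupp.smul_single, Finsupp.smul_single]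
      simp [b]
  obtain ⟨⟨D', δ⟩, h, h'⟩ := h D
  refine ⟨δ, ?_⟩
  rw [hD, Finsupp.single_zero, sub_zero] at h'
  rw [← h']
  exact h

/-- Slope 1 all the way around a cycle has no divisor. Adding such circulations changes the total
increment around one cycle by a period. -/
theorem circulation_mem_ordIncrement (i : Fin g) :
    ((0 : C.graph.Divisor), (Pi.single (C.arcEdge i) (C.arc i) +
      Pi.single (C.coarcEdge i) (C.coarc i) : C.Edge → ℝ)) ∈ C.graph.ordIncrement := by
  have h1 := single_sub_single_mem_ordIncrement (Γ := C.graph) (C.arcEdge i)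
    (t := C.graph.len (C.arcEdge i)) ⟨(C.graph.len_pos _).le, le_rfl⟩
  have h2 := single_sub_single_mem_ordIncrement (Γ := C.graph) (C.coarcEdge i)
    (t := C.graph.len (C.coarcEdge i)) ⟨(C.graph.len_pos _).le, le_rfl⟩
  rw [pt_len] at h1 h2
  have := AddSubgroup.add_mem _ h1 h2
  rw [Prod.mk_add_mk] at this
  convert this using 2
  · exact (sub_add_sub_cancel' _ _ _ |>.trans (sub_self _)).symm
  · rfl

/-- With `y = 0` this describes linear equivalence; with general `y` it describes the universal
cover of `Pic^d`. For the converse, connectedness gives some edgewise function, whose totals are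
then right up to periods and are corrected by circulations. -/
theorem exists_mem_ordIncrement_iff (hg : 0 < g) (D : C.graph.Divisor) (y : Fin g → ℝ) :
    (∃ δ, (D, δ) ∈ C.graph.ordIncrement ∧ ∀ i, δ (C.arcEdge i) + δ (C.coarcEdge i) = y i) ↔
      C.graph.degreeHom D = 0 ∧
        ∀ i, C.coord i D = -(y i : AddCircle (C.cycleLength i)) := by
  constructor
  · rintro ⟨δ, h, hy⟩
    refine ⟨degree_eq_zero_of_mem_ordIncrement h, fun i => ?_⟩
    rw [C.coord_eq_of_mem_ordIncrement h, hy]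
  · rintro ⟨h0, h⟩
    obtain ⟨δ, hδ⟩ := C.exists_mem_ordIncrement hg h0
    have : ∀ i, ∃ n : ℤ, n • C.cycleLength i = y i - (δ (C.arcEdge i) + δ (C.coarcEdge i)) := by
      intro i
      have h1 := h i
      rw [C.coord_eq_of_mem_ordIncrement hδ, neg_inj] at h1
      exact (AddCircle.coe_eq_zero_iff (p := C.cycleLength i)).mp (by
        rw [AddCircle.coe_sub, h1, sub_self])
    choose n hn using this
    have hsum := AddSubgroup.add_mem _ hδ (AddSubgroup.sum_mem _ fun i (_ : i ∈ Finset.univ) =>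
      AddSubgroup.zsmul_mem _ (C.circulation_mem_ordIncrement i) (n i))
    refine ⟨δ + ∑ i, n i • (Pi.single (C.arcEdge i) (C.arc i) +
        Pi.single (C.coarcEdge i) (C.coarc i) : C.Edge → ℝ), ?_, ?_⟩
    · convert hsum using 1
      refine Prod.ext ?_ ?_
      · simp [Prod.fst_sum]
      · simp [Prod.snd_sum]
    · intro i
      have := hn i
      simp only [zsmul_eq_mul, cycleLength] at this
      simp only [Pi.add_apply, Finset.sum_apply, zsmul_eq_mul, Pi.mul_apply,
        Pi.intCast_apply]
      rw [Finset.sum_eq_single i, Finset.sum_eq_single i]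
      · simp
        linarith
      · intro j _ hj
        simp [Ne.symm hj]
      · simp
      · intro j _ hj
        simp [Ne.symm hj]
      · simp

/-- The cycles are the only obstruction: away from them the graph is a path, along which a potential
is summed up. -/
theorem exists_potential (δ : C.Edge → ℝ) (h : ∀ i, δ (C.arcEdge i) + δ (C.coarcEdge i) = 0) :
    ∃ f : C.Vertex → ℝ, ∀ e, δ e = f (C.graph.tgt e) - f (C.graph.src e) := by
  classical
  -- The increment from `v k` to `v (k + 1)`. A bridge of length 0 is not an edge and contributes 0.
  let c : ℕ → ℝ := fun k => (if h : k < g then δ (C.arcEdge ⟨k, h⟩) else 0) +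
    if h : ∃ h : k < g - 1, 0 < C.bridge ⟨k, h⟩ then δ (Sum.inr (Sum.inr ⟨⟨k, h.1⟩, h.2⟩)) else 0
  let P : ℕ → ℝ := fun n => ∑ k ∈ Finset.range n, c k
  let f := C.vertexFun (fun i => P i + δ (C.arcEdge i)) (fun i => P i)
  have hP : ∀ n, P (n + 1) = P n + c n := fun n => Finset.sum_range_succ _ _
  have hv : ∀ i, f (C.v i) = P i := by
    refine C.vertexFun_v _ _ fun k hk => ?_
    have h1 : (k : ℕ) < g := by omega
    have h2 : ¬ ∃ h : (k : ℕ) < g - 1, 0 < C.bridge ⟨k, h⟩ := by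
      rintro ⟨_, h⟩
      exact h.ne' hk
    simp only [hP, c, dif_pos h1, dif_neg h2, add_zero]
  have hw : ∀ i, f (C.w i) = P i + δ (C.arcEdge i) := fun i => rfl
  refine ⟨f, ?_⟩
  rintro (i | i | k)
  · change _ = f (C.w i) - f (C.v i)
    rw [hv, hw]; ring
  · change _ = f (C.v i) - f (C.w i)
    rw [hv, hw]
    linarith [h i]
  · change _ = f (C.v ⟨(k.1 : ℕ) + 1, by omega⟩) - f (C.w ⟨k.1, by omega⟩)
    have h1 : (k.1 : ℕ) < g := by omega
    have h2 : ∃ h : (k.1 : ℕ) < g - 1, 0 < C.bridge ⟨k.1, h⟩ := ⟨k.1.2, k.2⟩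
    rw [hv, hw]
    simp only [hP, c, dif_pos h1, dif_pos h2]
    ring

theorem mem_principal_iff (hg : 0 < g) (D : C.graph.Divisor) :
    D ∈ C.graph.principal ↔ C.graph.degreeHom D = 0 ∧ ∀ i, C.coord i D = 0 := by
  have := C.exists_mem_ordIncrement_iff hg D 0
  simp only [Pi.zero_apply, AddCircle.coe_zero, neg_zero] at this
  rw [← this]
  constructor
  · intro h
    obtain ⟨f, hf⟩ := exists_mem_ordIncrement_of_mem_principal h
    refine ⟨_, hf, fun i => ?_⟩
    change (f (C.w i) - f (C.v i)) + (f (C.v i) - f (C.w i)) = 0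
    ring
  · rintro ⟨δ, hδ, h⟩
    obtain ⟨f, hf⟩ := C.exists_potential δ h
    exact mem_principal_of_potential hδ f hf

/-- The Abel--Jacobi theorem for a chain of cycles. -/
theorem cls_eq_cls_iff (hg : 0 < g) {D D' : C.graph.Divisor} :
    cls D = cls D' ↔ degree D = degree D' ∧ ∀ i, C.coord i D = C.coord i D' := by
  rw [cls, cls, QuotientAddGroup.eq, C.mem_principal_iff hg, ← degreeHom_apply, ← degreeHom_apply]
  simp only [map_add, map_neg, neg_add_eq_zero]

end ChainOfCycles

end Tropical

/-! ### Effective divisors and their chip counts. -/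

namespace Tropical

namespace ChainOfCycles

open MetricGraph

variable {g : ℕ} (C : ChainOfCycles g)

/-- The class of `w i` in the circle `C i`, with `v i` as origin. -/
noncomputable abbrev arcClass (i : Fin g) : AddCircle (C.cycleLength i) :=
  (C.arc i : AddCircle (C.cycleLength i))

/-- The arc is positive and shorter than the cycle. This makes tableau columns strict and excludes
torsion order 1. -/
theorem arcClass_ne_zero (i : Fin g) : C.arcClass i ≠ 0 := by
  intro h
  obtain ⟨n, hn⟩ := (AddCircle.coe_eq_zero_iff (p := C.cycleLength i)).mp h
  have h1 := C.arc_pos i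
  have h2 := C.coarc_pos i
  rw [zsmul_eq_mul, cycleLength] at hn
  have h3 : 0 < n := by
    by_contra h
    have : (n : ℝ) ≤ 0 := by exact_mod_cast not_lt.mp h
    nlinarith
  have : (1 : ℝ) ≤ n := by exact_mod_cast h3
  nlinarith

theorem pos_vtx (i : Fin g) (x : C.Vertex) : C.pos i (C.graph.vtx x) = C.posVertex i x := rfl

theorem pos_inn (i : Fin g) (e : C.Edge) (t : Set.Ioo (0 : ℝ) (C.graph.len e)) :
    C.pos i (C.graph.inn e t) = C.posStart i e + C.posSpeed i e * t := rfl

/-- The point `p` lies on the cycle `i` as far as the projections to the other cycles are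
concerned. -/
def LiesOver (p : C.graph.Point) (i : Fin g) : Prop :=
  ∀ j, (j < i → C.pos j p = C.arc j) ∧ (i < j → C.pos j p = 0)

theorem liesOver_v (i : Fin g) : C.LiesOver (C.graph.vtx (C.v i)) i := fun j => by
  rw [pos_vtx, posVertex_v]
  exact ⟨fun h => if_neg h.not_ge, fun h => if_pos h.le⟩

theorem liesOver_w (i : Fin g) : C.LiesOver (C.graph.vtx (C.w i)) i := fun j => by
  rw [pos_vtx, posVertex_w]
  exact ⟨fun h => if_neg h.not_gt, fun h => if_pos h⟩

theorem liesOver_inn_arcEdge (i : Fin g) (t : Set.Ioo (0 : ℝ) (C.graph.len (C.arcEdge i))) :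
    C.LiesOver (C.graph.inn (C.arcEdge i) t) i := fun j => by
  rw [pos_inn, posStart, posSpeed]
  exact ⟨fun h => by simp [h.not_ge, h.ne'], fun h => by simp [h.le, h.ne]⟩

theorem liesOver_inn_coarcEdge (i : Fin g) (t : Set.Ioo (0 : ℝ) (C.graph.len (C.coarcEdge i))) :
    C.LiesOver (C.graph.inn (C.coarcEdge i) t) i := fun j => by
  rw [pos_inn, posStart, posSpeed]
  exact ⟨fun h => by simp [h.not_gt, h.ne'], fun h => by simp [h, h.ne]⟩

theorem exists_liesOver (p : C.graph.Point) : ∃ i, C.LiesOver p i := by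
  induction p using Point.cases with
  | vtx x =>
    exact C.forall_vertex (P := fun x => ∃ i, C.LiesOver (C.graph.vtx x) i)
      (fun i => ⟨i, C.liesOver_v i⟩) (fun i => ⟨i, C.liesOver_w i⟩) x
  | inn e t =>
    rcases e with i | i | k
    · exact ⟨i, C.liesOver_inn_arcEdge i t⟩
    · exact ⟨i, C.liesOver_inn_coarcEdge i t⟩
    · refine ⟨⟨k.1, by omega⟩, fun j => ?_⟩
      rw [pos_inn, posStart, posSpeed]
      simp only [Fin.lt_def]
      exact ⟨fun h => by simp [h.not_gt], fun h => by simp [h]⟩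

theorem exists_point (i : Fin g) (θ : AddCircle (C.cycleLength i)) :
    ∃ p, C.LiesOver p i ∧ (C.pos i p : AddCircle (C.cycleLength i)) = θ := by
  have : Fact (0 < C.cycleLength i) := ⟨C.cycleLength_pos i⟩
  have hθ : θ ∈ ((↑) '' Set.Ico (0 : ℝ) (0 + C.cycleLength i) : Set (AddCircle (C.cycleLength i))) := by
    rw [AddCircle.coe_image_Ico_eq]; trivial
  obtain ⟨t, ⟨h0, h1⟩, rfl⟩ := hθ
  rw [zero_add, cycleLength] at h1
  rcases h0.eq_or_lt with rfl | h0
  · refine ⟨_, C.liesOver_v i, ?_⟩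
    rw [pos_vtx, posVertex_v, if_pos le_rfl]
  rcases lt_trichotomy t (C.arc i) with h | rfl | h
  · refine ⟨_, C.liesOver_inn_arcEdge i ⟨t, h0, h⟩, ?_⟩
    simp [pos_inn, posStart, posSpeed]
  · refine ⟨_, C.liesOver_w i, ?_⟩
    rw [pos_vtx, posVertex_w, if_neg (lt_irrefl _)]
  · refine ⟨_, C.liesOver_inn_coarcEdge i ⟨t - C.arc i, sub_pos.mpr h, ?_⟩, ?_⟩
    · change t - C.arc i < C.coarc i
      linarith
    · congr 1
      simp [pos_inn, posStart, posSpeed]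

/-- These are the points between cycles, and at the two ends, where the adversary of
`low_nonneg_of_rankAtLeast` removes chips. -/
theorem exists_junction (hg : 0 < g) {k : ℕ} (hk : k ≤ g) :
    ∃ p, ∀ i, C.pos i p = if (i : ℕ) < k then C.arc i else 0 := by
  rcases k with _ | k
  · refine ⟨C.graph.vtx (C.v ⟨0, hg⟩), fun i => ?_⟩
    rw [pos_vtx, posVertex_v]
    simp [Fin.le_def]
  · refine ⟨C.graph.vtx (C.w ⟨k, hk⟩), fun i => ?_⟩
    rw [pos_vtx, posVertex_w]
    simp only [Fin.lt_def, Nat.lt_succ_iff]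
    rcases lt_or_ge k i with h | h
    · rw [if_pos h, if_neg h.not_ge]
    · rw [if_neg h.not_gt, if_pos h]

/-- `c i` is the number of chips on the cycles `i, i + 1, …` of an effective divisor of degree `d`
with Abel--Jacobi coordinates `x`. -/
structure IsProfile (d : ℤ) (x : ∀ i, AddCircle (C.cycleLength i)) (c : ℕ → ℤ) : Prop where
  zero : c 0 = d
  last : c g = 0
  anti : ∀ i < g, c (i + 1) ≤ c i
  stay : ∀ i : Fin g, c (i + 1) = c i → x i = c (i + 1) • C.arcClass i

/-- Assign each chip to a cycle over which it lies. At cycle `i`, chips further right project to `w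
i`, chips further left to `v i`, which is the origin; `S i` collects the chips on the cycle itself.
-/
theorem exists_chip_counts {B : C.graph.Divisor} (hB : Effective B) :
    ∃ (c : ℕ → ℤ) (S : ∀ i, AddCircle (C.cycleLength i)), c 0 = degree B ∧ c g = 0 ∧
      (∀ i, c (i + 1) ≤ c i) ∧
      ∀ i : Fin g, C.coord i B = S i + c (i + 1) • C.arcClass i ∧ (c (i + 1) = c i → S i = 0) := by
  choose o ho using C.exists_liesOver
  refine ⟨fun n => ∑ p ∈ B.support, if n ≤ o p then B p else 0,
    fun i => ∑ p ∈ B.support, if o p = i then B p • (C.pos i p : AddCircle (C.cycleLength i)) else 0,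
    ?_, ?_, ?_, ?_⟩
  · simp [degree, Finsupp.sum]
  · exact Finset.sum_eq_zero fun p _ => if_neg (o p).2.not_ge
  · intro i
    refine Finset.sum_le_sum fun p _ => ?_
    have := hB p
    split_ifs <;> omega
  · intro i
    constructor
    · have h1 : C.coord i B =
          ∑ p ∈ B.support, B p • (C.pos i p : AddCircle (C.cycleLength i)) := by
        rw [coord_apply, Finsupp.sum]
        exact map_sum (QuotientAddGroup.mk' (AddSubgroup.zmultiples (C.cycleLength i))) _ _
      rw [h1, Finset.sum_smul, ← Finset.sum_add_distrib]
      refine Finset.sum_congr rfl fun p _ => ?_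
      rcases lt_trichotomy (o p) i with h | h | h
      · have h2 : ¬ (i : ℕ) + 1 ≤ o p := by simp only [Fin.lt_def] at h; omega
        rw [if_neg h.ne, if_neg h2, ((ho p i).2 h)]
        simp
      · have h2 : ¬ (i : ℕ) + 1 ≤ o p := by rw [h]; omega
        rw [if_pos h, if_neg h2]
        simp
      · have h2 : (i : ℕ) + 1 ≤ o p := by simp only [Fin.lt_def] at h; omega
        rw [if_neg h.ne', if_pos h2, ((ho p i).1 h)]
        simp
    · intro h
      have h1 : ∑ p ∈ B.support, (if o p = i then B p else 0) = 0 := by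
        have h' : (∑ p ∈ B.support, if (i : ℕ) ≤ o p then B p else 0) -
            (∑ p ∈ B.support, if (i : ℕ) + 1 ≤ o p then B p else 0) = 0 := sub_eq_zero.mpr h.symm
        refine Eq.trans ?_ h'
        rw [← Finset.sum_sub_distrib]
        refine Finset.sum_congr rfl fun p _ => ?_
        rcases lt_trichotomy (o p : ℕ) i with h | h | h
        · rw [if_neg (fun h' => h.ne (congrArg _ h')), if_neg (by omega), if_neg (by omega)]; simp
        · rw [if_pos (Fin.ext h), if_pos (by omega), if_neg (by omega)]; simp
        · rw [if_neg (fun h' => h.ne' (congrArg _ h')), if_pos (by omega), if_pos (by omega)]; simp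
      have h2 := (Finset.sum_eq_zero_iff_of_nonneg (fun p _ => by
        split_ifs
        · exact hB p
        · exact le_rfl)).mp h1
      refine Finset.sum_eq_zero fun p hp => ?_
      have := h2 p hp
      split_ifs at this ⊢ with h3
      · rw [this, zero_smul]
      · rfl

theorem exists_isProfile {B : C.graph.Divisor} (hB : Effective B) :
    ∃ c, C.IsProfile (degree B) (fun i => C.coord i B) c := by
  obtain ⟨c, S, h0, hg, hanti, h⟩ := C.exists_chip_counts hB
  refine ⟨c, h0, hg, fun i _ => hanti i, fun i hi => ?_⟩
  rw [(h i).1, (h i).2 hi, zero_add]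

theorem sum_range_ite_lt_sub (c : ℕ → ℤ) (j n : ℕ) (h : j + 1 ≤ n) :
    ∑ i ∈ Finset.range n, (if j < i then c i - c (i + 1) else 0) = c (j + 1) - c n := by
  induction n, h using Nat.le_induction with
  | base =>
    rw [sub_self]
    exact Finset.sum_eq_zero fun i hi => if_neg (by have := Finset.mem_range.mp hi; omega)
  | succ n hn ih =>
    rw [Finset.sum_range_succ, ih, if_pos (by omega)]
    ring

/-- On each cycle with chips, one chip is placed freely to adjust the coordinate and the rest go to
coordinate 0. A cycle without chips already has the right coordinate by `stay`. -/
theorem IsProfile.exists_effective {C : ChainOfCycles g} {d : ℤ}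
    {x : ∀ i, AddCircle (C.cycleLength i)} {c : ℕ → ℤ} (hc : C.IsProfile d x c) :
    ∃ B : C.graph.Divisor, Effective B ∧ degree B = d ∧ ∀ i, C.coord i B = x i := by
  choose P hP hP' using C.exists_point
  let B : Fin g → C.graph.Divisor := fun i => if c (i + 1) = c i then 0 else
    Finsupp.single (P i (x i - c (i + 1) • C.arcClass i)) 1 +
      Finsupp.single (P i 0) (c i - c (i + 1) - 1)
  have hdeg : ∀ i, C.graph.degreeHom (B i) = c i - c (i + 1) := by
    intro i
    simp only [B]
    split_ifs with h
    · rw [map_zero, h, sub_self]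
    · rw [map_add, degreeHom_single, degreeHom_single]; ring
  have hcoord : ∀ j i, C.coord j (B i) =
      (if i = j then x j - c (j + 1) • C.arcClass j else 0) +
        (if j < i then c i - c (i + 1) else 0) • C.arcClass j := by
    intro j i
    simp only [B]
    split_ifs with h1 h2 h3 h3 h2 h3 h3
    · subst h2; exact absurd h3 (lt_irrefl _)
    · subst h2; rw [map_zero, hc.stay i h1, sub_self, zero_smul, add_zero]
    · rw [map_zero, h1, sub_self, zero_smul, add_zero]
    · rw [map_zero, zero_smul, add_zero]
    · subst h2; exact absurd h3 (lt_irrefl _)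
    · subst h2
      rw [map_add, coord_single, coord_single, hP', hP']
      simp
    · rw [map_add, coord_single, coord_single, (hP i _ j).1 h3, (hP i _ j).1 h3, ← add_smul]
      simp
    · have h4 : i < j := lt_of_le_of_ne (not_lt.mp h3) h2
      rw [map_add, coord_single, coord_single, (hP i _ j).2 h4, (hP i _ j).2 h4]
      simp
  refine ⟨∑ i, B i, ?_, ?_, ?_⟩
  · intro p
    rw [Finsupp.finsetSum_apply]
    refine Finset.sum_nonneg fun i _ => ?_
    simp only [B]
    split_ifs with h
    · rfl
    · have h1 := lt_of_le_of_ne (hc.anti i i.2) h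
      have h2 : (0 : C.graph.Divisor) ≤
          Finsupp.single (P i (x i - c (i + 1) • C.arcClass i)) 1 +
            Finsupp.single (P i 0) (c i - c (i + 1) - 1) :=
        add_nonneg (Finsupp.single_nonneg.mpr zero_le_one)
          (Finsupp.single_nonneg.mpr (by linarith))
      exact h2 p
  · rw [← degreeHom_apply, map_sum, Finset.sum_congr rfl fun i _ => hdeg i,
      Fin.sum_univ_eq_sum_range (fun i => c i - c (i + 1)), Finset.sum_range_sub', hc.zero, hc.last,
      sub_zero]
  · intro j
    rw [map_sum, Finset.sum_congr rfl fun i _ => hcoord j i, Finset.sum_add_distrib,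
      ← Finset.sum_smul]
    simp only [Finset.sum_ite_eq', Finset.mem_univ, if_true, Fin.lt_def]
    rw [Fin.sum_univ_eq_sum_range (fun i => if (j : ℕ) < i then c i - c (i + 1) else 0),
      sum_range_ite_lt_sub c j g j.2, hc.last, sub_zero, sub_add_cancel]

theorem exists_divisor (hg : 0 < g) (d : ℤ) (x : ∀ i, AddCircle (C.cycleLength i)) :
    ∃ D : C.graph.Divisor, degree D = d ∧ ∀ i, C.coord i D = x i := by
  let A : C.graph.Divisor := Finsupp.single (C.graph.vtx (C.v ⟨0, hg⟩)) (d - g)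
  -- One chip on each cycle realises every coordinate vector (Jacobi inversion); `A` corrects the
  -- degree.
  have : C.IsProfile g (fun i => x i - C.coord i A) fun i => (g : ℤ) - i :=
    ⟨by simp, by simp, fun i _ => by push_cast; linarith, fun i h => by
      push_cast at h; linarith⟩
  obtain ⟨B, -, hB, hB'⟩ := this.exists_effective
  refine ⟨B + A, ?_, fun i => ?_⟩
  · rw [← degreeHom_apply, map_add, degreeHom_single, degreeHom_apply, hB]
    ring
  · rw [map_add, hB', sub_add_cancel]

theorem rankAtLeast_iff (hg : 0 < g) (D : C.graph.Divisor) (r : ℕ) :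
    RankAtLeast D r ↔ ∀ A : C.graph.Divisor, Effective A → degree A = r →
      ∃ c, C.IsProfile (degree D - r) (fun i => C.coord i D - C.coord i A) c := by
  refine forall_congr' fun A => forall_congr' fun hA => forall_congr' fun hA' => ?_
  have hdeg : degree (D - A) = degree D - r := by
    rw [← hA', ← degreeHom_apply, ← degreeHom_apply, ← degreeHom_apply, map_sub]
  constructor
  · rintro ⟨B, hB, h⟩
    obtain ⟨h1, h2⟩ := (C.cls_eq_cls_iff hg).mp h
    obtain ⟨c, hc⟩ := C.exists_isProfile hB
    refine ⟨c, ?_⟩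
    rw [h1, hdeg] at hc
    simpa only [h2, map_sub] using hc
  · rintro ⟨c, hc⟩
    obtain ⟨B, hB, h1, h2⟩ := hc.exists_effective
    exact ⟨B, hB, (C.cls_eq_cls_iff hg).mpr ⟨by rw [h1, hdeg], fun i => by rw [h2, map_sub]⟩⟩

end ChainOfCycles

end Tropical

/-! ### Rank and tableaux. -/

namespace Tropical

/-- A filling of a rectangle with symbols, strictly increasing along rows and columns. -/
structure IsTableau {m s g : ℕ} (t : Fin m → Fin s → Fin g) : Prop where
  row : ∀ j, StrictMono (t j)
  col : ∀ k, StrictMono fun j => t j k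

/-- The number of entries smaller than `n`. -/
def countBelow {s g : ℕ} (f : Fin s → Fin g) (n : ℕ) : ℕ :=
  (Finset.univ.filter fun k => (f k : ℕ) < n).card

theorem countBelow_of_eq {s g : ℕ} {f : Fin s → Fin g} (hf : StrictMono f) {n : ℕ} {k : Fin s}
    (hk : (f k : ℕ) = n) : countBelow f n = k ∧ countBelow f (n + 1) = k + 1 := by
  subst hk
  constructor
  · have : (Finset.univ.filter fun k' => (f k' : ℕ) < f k) = Finset.Iio k := by
      ext k'
      simp [hf.lt_iff_lt]
    rw [countBelow, this, Fin.card_Iio]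
  · have : (Finset.univ.filter fun k' => (f k' : ℕ) < f k + 1) = Finset.Iic k := by
      ext k'
      simp [hf.le_iff_le]
    rw [countBelow, this, Fin.card_Iic]

theorem countBelow_succ_of_ne {s g : ℕ} {f : Fin s → Fin g} {n : ℕ}
    (h : ∀ k, (f k : ℕ) ≠ n) : countBelow f (n + 1) = countBelow f n := by
  rw [countBelow, countBelow]
  congr 1
  ext k
  have := h k
  simp only [Finset.mem_filter, Finset.mem_univ, true_and]
  omega

theorem countBelow_succ_le {s g : ℕ} {f : Fin s → Fin g} (hf : StrictMono f) (n : ℕ) :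
    countBelow f (n + 1) ≤ countBelow f n + 1 := by
  by_cases h : ∃ k, (f k : ℕ) = n
  · obtain ⟨k, hk⟩ := h
    rw [(countBelow_of_eq hf hk).1, (countBelow_of_eq hf hk).2]
  · rw [countBelow_succ_of_ne (not_exists.mp h)]
    omega

theorem IsTableau.countBelow_succ_le_of_lt {m s g : ℕ} {t : Fin m → Fin s → Fin g}
    (ht : IsTableau t) {j j' : Fin m} (hj : j < j') (n : ℕ) :
    countBelow (t j') (n + 1) ≤ countBelow (t j) n := by
  refine Finset.card_le_card fun k => ?_
  have : (t j k : ℕ) < t j' k := Fin.lt_def.mp (ht.col k hj)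
  simp only [Finset.mem_filter, Finset.mem_univ, true_and]
  omega

theorem countBelow_all {s g : ℕ} (f : Fin s → Fin g) : countBelow f g = s := by
  rw [countBelow, Finset.filter_true_of_mem fun k _ => (f k).2]
  simp

theorem exists_lt_and_jump (f : ℕ → ℤ) (h0 : f 0 = 0) (hf : ∀ n, f (n + 1) ≤ f n + 1) {k : ℤ}
    (hk : 0 ≤ k) (g : ℕ) (hg : k + 1 ≤ f g) : ∃ n < g, f n = k ∧ f (n + 1) = k + 1 := by
  induction g with
  | zero => omega
  | succ g ih =>
    by_cases h : k + 1 ≤ f g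
    · obtain ⟨n, hn, h⟩ := ih h
      exact ⟨n, by omega, h⟩
    · have := hf g
      exact ⟨g, by omega, by omega, by omega⟩

namespace ChainOfCycles

open MetricGraph

variable {g : ℕ} (C : ChainOfCycles g)

/-- The coordinates `x` lie on the torus attached to the filling `t`. -/
def OnTorus (d : ℤ) {m s : ℕ} (t : Fin m → Fin s → Fin g) (x : ∀ i, AddCircle (C.cycleLength i)) :
    Prop :=
  ∀ j k, x (t j k) = (d - (t j k : ℕ) + (k : ℕ) - (j : ℕ)) • C.arcClass (t j k)

theorem OnTorus.eq_of_eq {C : ChainOfCycles g} {d : ℤ} {m s : ℕ} {t : Fin m → Fin s → Fin g}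
    {x : ∀ i, AddCircle (C.cycleLength i)} (h : C.OnTorus d t x) {j : Fin m} {k : Fin s} {i : Fin g}
    (hi : t j k = i) : x i = (d - (i : ℕ) + (k : ℕ) - (j : ℕ)) • C.arcClass i := by
  subst hi
  exact h j k

section Greedy

open Classical in
/-- The greedy choice when `u` chips arrive at the cycle `i`. -/
noncomputable def greedyStep (x : ∀ i, AddCircle (C.cycleLength i)) (i : ℕ) (u : ℤ) : ℤ :=
  if ∃ h : i < g, x ⟨i, h⟩ = u • C.arcClass ⟨i, h⟩ then u else u - 1

variable {C} {x : ∀ i, AddCircle (C.cycleLength i)} {i : ℕ} {u u' : ℤ}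

theorem greedyStep_le : C.greedyStep x i u ≤ u := by
  rw [greedyStep]; split_ifs <;> linarith

theorem sub_one_le_greedyStep : u - 1 ≤ C.greedyStep x i u := by
  rw [greedyStep]; split_ifs <;> linarith

/-- A step loses at most one chip, so a strictly larger integer cannot fall behind. -/
theorem greedyStep_mono (h : u ≤ u') : C.greedyStep x i u ≤ C.greedyStep x i u' := by
  rcases h.eq_or_lt with rfl | h
  · rfl
  · have h1 := greedyStep_le (C := C) (x := x) (i := i) (u := u)
    have h2 := sub_one_le_greedyStep (C := C) (x := x) (i := i) (u := u')
    linarith [Int.add_one_le_of_lt h]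

theorem greedyStep_eq_self_iff :
    C.greedyStep x i u = u ↔ ∃ h : i < g, x ⟨i, h⟩ = u • C.arcClass ⟨i, h⟩ := by
  rw [greedyStep]
  split_ifs with h
  · simp [h]
  · simp [h]

/-- Chips left over at the end are all put on the last cycle, so `c g` need only be nonnegative. -/
theorem exists_isProfile_of_greedy (hg : 0 < g) (d : ℤ) (c : ℕ → ℤ) (h0 : c 0 = d)
    (hc : ∀ i, c (i + 1) = C.greedyStep x i (c i)) (hlast : 0 ≤ c g) :
    ∃ c', C.IsProfile d x c' := by
  obtain ⟨n, rfl⟩ : ∃ n, g = n + 1 := ⟨g - 1, by omega⟩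
  have hanti : ∀ i, c (i + 1) ≤ c i := fun i => by rw [hc]; exact greedyStep_le
  have hstay : ∀ i : Fin (n + 1), c (i + 1) = c i → x i = c (i + 1) • C.arcClass i := by
    intro i h
    rw [h]
    rw [hc] at h
    obtain ⟨_, h⟩ := greedyStep_eq_self_iff.mp h
    exact h
  refine ⟨fun i => if i < n + 1 then c i else 0, by simp [h0], by simp, ?_, ?_⟩
  · intro i hi
    rcases Nat.lt_succ_iff_lt_or_eq.mp hi with h | rfl
    · simp only [if_pos hi, if_pos (Nat.succ_lt_succ h)]
      exact hanti i
    · simp only [if_pos hi, lt_irrefl, if_false]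
      exact hlast.trans (hanti _)
  · intro i h
    rcases Nat.lt_succ_iff_lt_or_eq.mp i.2 with h' | h'
    · simp only [if_pos i.2, if_pos (Nat.succ_lt_succ h')] at h ⊢
      exact hstay i h
    · simp only [h', lt_irrefl, if_false, Nat.lt_succ_self, if_true] at h ⊢
      have h2 := hanti n
      have h3 := hstay i (by rw [h']; omega)
      rw [h3, h', show c (n + 1) = 0 by omega]

end Greedy

/-- Play greedily on `D - A`. With `b i` chips of `A` still ahead, `j = r - b i` have been passed,
and row `j` guarantees the lower bound `key`. A chip of `A` on cycle `i` moves play to a later row,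
where strict columns preserve the bound. At the end row `r` has contributed all `s` symbols, leaving
at least `degree D - r - g + s = 0` chips. -/
theorem rankAtLeast_of_isTableau (hg : 0 < g) {D : C.graph.Divisor} {r s : ℕ}
    (hs : (s : ℤ) = g - degree D + r) {t : Fin (r + 1) → Fin s → Fin g} (ht : IsTableau t)
    (hD : C.OnTorus (degree D) t fun i => C.coord i D) : RankAtLeast D r := by
  rw [C.rankAtLeast_iff hg]
  intro A hA hA'
  obtain ⟨b, S, hb0, hbg, hb, hbS⟩ := C.exists_chip_counts hA
  let x : ∀ i, AddCircle (C.cycleLength i) := fun i => C.coord i D - C.coord i A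
  let c : ℕ → ℤ := fun n => Nat.rec (degree D - r) (fun i u => C.greedyStep x i u) n
  have hc0 : c 0 = degree D - r := rfl
  have hc : ∀ i, c (i + 1) = C.greedyStep x i (c i) := fun i => rfl
  have hanti : Antitone b := antitone_nat_of_succ_le hb
  have hbr : ∀ i, b i ≤ r := fun i => by
    have := hanti (Nat.zero_le i); omega
  have hbpos : ∀ i ≤ g, 0 ≤ b i := fun i hi => by
    have := hanti hi; omega
  have key : ∀ i ≤ g, ∀ j : Fin (r + 1), ((j : ℕ) : ℤ) = r - b i →
      degree D - (j : ℕ) - i + countBelow (t j) i ≤ c i + b i := by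
    intro i
    induction i with
    | zero =>
      intro _ j hj
      have : countBelow (t j) 0 = 0 := by simp [countBelow]
      rw [this, hc0]
      push_cast
      omega
    | succ i ih =>
      intro hi j' hj'
      have hi' : i ≤ g := by omega
      have h1 := hbr i
      have h2 := hbpos i hi'
      let j : Fin (r + 1) := ⟨(r - b i).toNat, by omega⟩
      have hj : ((j : ℕ) : ℤ) = r - b i := by simp only [j]; omega
      have ih := ih hi' j hj
      have hlow := sub_one_le_greedyStep (C := C) (x := x) (i := i) (u := c i)
      rw [← hc] at hlow
      rcases (hb i).eq_or_lt with h | h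
      · have hjj : j' = j := Fin.ext (by omega)
        rw [hjj]
        have hle := countBelow_succ_le (ht.row j) i
        by_cases hex : ∃ k, (t j k : ℕ) = i
        · obtain ⟨k, hk⟩ := hex
          obtain ⟨h3, h4⟩ := countBelow_of_eq (ht.row j) hk
          rw [h4]
          rw [h3] at ih
          -- If the bound is tight, the torus condition at symbol `i` is exactly the condition for
          -- passing without loss; otherwise the slack pays for a lost chip.
          rcases ih.eq_or_lt with h5 | h5
          · have : C.greedyStep x i (c i) = c i := by
              rw [greedyStep_eq_self_iff]
              refine ⟨hi, ?_⟩
              have h6 := hD.eq_of_eq (show t j k = ⟨i, hi⟩ from Fin.ext hk)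
              have h8 := hbS ⟨i, hi⟩
              have h9 : S ⟨i, hi⟩ = 0 := h8.2 h
              have h10 : C.coord ⟨i, hi⟩ A = b (i + 1) • C.arcClass ⟨i, hi⟩ := by
                rw [h8.1, h9, zero_add]
              change C.coord ⟨i, hi⟩ D - C.coord ⟨i, hi⟩ A = _
              rw [show C.coord ⟨i, hi⟩ D = _ from h6, h10, ← sub_smul]
              congr 1
              push_cast
              omega
            rw [hc, this, h]
            push_cast
            omega
          · push_cast
            omega
        · rw [countBelow_succ_of_ne (not_exists.mp hex)]
          push_cast
          omega
      · have hjj : j < j' := Fin.lt_def.mpr (by omega)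
        have := ht.countBelow_succ_le_of_lt hjj i
        push_cast
        omega
  refine exists_isProfile_of_greedy (x := x) hg _ c hc0 hc ?_
  have := key g le_rfl (Fin.last r) (by rw [hbg]; simp)
  rw [countBelow_all, hbg, Fin.val_last] at this
  omega

section Adversary

/-- Given the values `p 0 > p 1 > …` reachable before a cycle after the removal of `0, 1, …` chips,
the lowest values reachable after it. -/
def nextLow (f : ℤ → ℤ) (p : ℕ → ℤ) : ℕ → ℤ
  | 0 => f (p 0)
  | j + 1 => min (f (p (j + 1))) (nextLow f p j - 1)

/-- The least number of chips that can be enforced to arrive at the cycle `i` by the removal of `j`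
chips, where the removed chips are placed at the junctions between cycles. -/
noncomputable def low (d : ℤ) (x : ∀ i, AddCircle (C.cycleLength i)) : ℕ → ℕ → ℤ
  | 0 => fun j => d - j
  | i + 1 => nextLow (C.greedyStep x i) (low d x i)

variable {C} {d : ℤ} {x : ∀ i, AddCircle (C.cycleLength i)}

theorem low_succ_le_greedyStep (i j : ℕ) :
    C.low d x (i + 1) j ≤ C.greedyStep x i (C.low d x i j) := by
  rcases j with _ | j
  · exact le_rfl
  · exact min_le_left _ _

theorem low_succ_right_le (i j : ℕ) : C.low d x i (j + 1) ≤ C.low d x i j - 1 := by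
  rcases i with _ | i
  · simp only [low]; push_cast; linarith
  · exact min_le_right _ _

theorem low_succ_le (i j : ℕ) : C.low d x (i + 1) j ≤ C.low d x i j :=
  (low_succ_le_greedyStep i j).trans greedyStep_le

theorem low_sub_one_le (i j : ℕ) : C.low d x i j - 1 ≤ C.low d x (i + 1) j := by
  induction j with
  | zero => exact sub_one_le_greedyStep
  | succ j ih =>
    refine le_min sub_one_le_greedyStep ?_
    have := low_succ_right_le (C := C) (d := d) (x := x) i j
    change _ ≤ C.low d x (i + 1) j - 1
    linarith

/-- The new minimum is at most the greedy value, so if it does not drop, the greedy step lost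
nothing. -/
theorem eq_smul_of_low_succ_eq {i : Fin g} {j : ℕ} (h : C.low d x (i + 1) j = C.low d x i j) :
    x i = C.low d x i j • C.arcClass i := by
  have h1 := low_succ_le_greedyStep (C := C) (d := d) (x := x) i j
  rw [h] at h1
  obtain ⟨_, h2⟩ := greedyStep_eq_self_iff.mp (le_antisymm greedyStep_le h1)
  exact h2

/-- Here `b k` is the number of chips removed at junction `k`, and `c` counts chips with all removed
ones added back. The strategy follows the two branches of the minimum in `nextLow`. -/
theorem exists_removal (i : ℕ) (hi : i ≤ g) (j : ℕ) : ∃ b : ℕ → ℕ,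
    ∑ k ∈ Finset.range (i + 1), b k = j ∧ ∀ c : ℕ → ℤ, c 0 = d → (∀ k < i, c (k + 1) ≤ c k) →
      (∀ k : Fin g, (k : ℕ) < i → c (k + 1) = c k →
        x k = (c (k + 1) - (∑ l ∈ Finset.range (k + 1), b l : ℕ)) • C.arcClass k) →
      c i ≤ C.low d x i j + j := by
  induction i generalizing j with
  | zero =>
    refine ⟨fun _ => j, by simp, fun c h0 _ _ => ?_⟩
    rw [h0, low]
    linarith
  | succ i ih =>
    have hupd : ∀ (b : ℕ → ℕ) (v n : ℕ), n < i + 1 →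
        ∑ l ∈ Finset.range (n + 1), Function.update b (i + 1) v l =
          ∑ l ∈ Finset.range (n + 1), b l := fun b v n hn =>
      Finset.sum_congr rfl fun l hl => Function.update_of_ne
        (by have := Finset.mem_range.mp hl; omega) _ _
    -- First branch: all `j` chips are removed before cycle `i`, none at the new junction `i + 1`.
    have hstep : ∀ j, ∃ b : ℕ → ℕ,
      ∑ k ∈ Finset.range (i + 1 + 1), b k = j ∧ ∀ c : ℕ → ℤ, c 0 = d →
        (∀ k < i + 1, c (k + 1) ≤ c k) →
        (∀ k : Fin g, (k : ℕ) < i + 1 → c (k + 1) = c k →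
          x k = (c (k + 1) - (∑ l ∈ Finset.range (k + 1), b l : ℕ)) • C.arcClass k) →
        c (i + 1) ≤ C.greedyStep x i (C.low d x i j) + j := by
      intro j
      obtain ⟨b, hb, h⟩ := ih (by omega) j
      refine ⟨Function.update b (i + 1) 0, ?_, fun c h0 hanti hc => ?_⟩
      · rw [Finset.sum_range_succ, hupd b 0 i (by omega), hb]
        simp
      · have h1 := h c h0 (fun k hk => hanti k (by omega)) fun k hk hk' => by
          rw [hc k (by omega) hk', hupd b 0 k (by omega)]
        have h2 : c (i + 1) - j ≤ C.greedyStep x i (c i - j) := by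
          rcases (hanti i (by omega)).eq_or_lt with h3 | h3
          · have h4 := hc ⟨i, by omega⟩ (by simp) h3
            simp only [hupd b 0 i (by omega), hb] at h4
            rw [h3] at h4
            rw [h3, greedyStep_eq_self_iff.mpr ⟨by omega, h4⟩]
          · have := sub_one_le_greedyStep (C := C) (x := x) (i := i) (u := c i - j)
            omega
        have h3 := greedyStep_mono (C := C) (x := x) (i := i)
          (show c i - j ≤ C.low d x i j by linarith)
        linarith
    induction j with
    | zero => exact hstep 0
    | succ j ihj =>
      -- Second branch, when the first is not optimal: remove `j` chips optimally through junction
      -- `i + 1`, and one further chip at that junction.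
      by_cases hmin : C.greedyStep x i (C.low d x i (j + 1)) ≤ C.low d x (i + 1) j - 1
      · obtain ⟨b, hb, h⟩ := hstep (j + 1)
        refine ⟨b, hb, fun c h0 hanti hc => ?_⟩
        have h1 : C.low d x (i + 1) (j + 1) = C.greedyStep x i (C.low d x i (j + 1)) :=
          min_eq_left hmin
        rw [h1]
        exact h c h0 hanti hc
      · obtain ⟨b, hb, h⟩ := ihj
        refine ⟨Function.update b (i + 1) (b (i + 1) + 1), ?_, fun c h0 hanti hc => ?_⟩
        · rw [Finset.sum_range_succ, hupd b _ i (by omega), Function.update_self, ← add_assoc,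
            ← Finset.sum_range_succ, hb]
        · have h1 : C.low d x (i + 1) (j + 1) = C.low d x (i + 1) j - 1 :=
            min_eq_right (not_le.mp hmin).le
          have h2 := h c h0 hanti fun k hk hk' => by
            rw [hc k hk hk', hupd b _ k hk]
          rw [h1]
          push_cast
          linarith

end Adversary

/-- The adversary's removals form an effective divisor `A` supported at junctions. A profile of `D -
A` ends at 0, while the strategy bounds its end by `low`. -/
theorem low_nonneg_of_rankAtLeast (hg : 0 < g) {D : C.graph.Divisor} {r : ℕ}
    (hD : RankAtLeast D r) : 0 ≤ C.low (degree D) (fun i => C.coord i D) g r := by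
  rw [C.rankAtLeast_iff hg] at hD
  obtain ⟨b, hb, h⟩ := exists_removal (C := C) (d := degree D) (x := fun i => C.coord i D) g le_rfl r
  have hq : ∀ k : Fin (g + 1), ∃ p, ∀ i, C.pos i p = if (i : ℕ) < k then C.arc i else 0 :=
    fun k => C.exists_junction hg (Nat.lt_succ_iff.mp k.2)
  choose q hq using hq
  let A : C.graph.Divisor := ∑ k : Fin (g + 1), Finsupp.single (q k) (b k : ℤ)
  have hA : Effective A := by
    have : 0 ≤ A := Finset.sum_nonneg fun k _ => Finsupp.single_nonneg.mpr (by positivity)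
    exact fun p => this p
  have hA' : degree A = r := by
    rw [← degreeHom_apply, map_sum]
    simp only [degreeHom_single]
    rw [Fin.sum_univ_eq_sum_range (fun k => (b k : ℤ)), ← hb]
    push_cast
    rfl
  have hcoord : ∀ i, C.coord i A =
      (r - (∑ l ∈ Finset.range (i + 1), b l : ℕ) : ℤ) • C.arcClass i := by
    intro i
    have h1 : ∀ k : Fin (g + 1), C.coord i (Finsupp.single (q k) (b k : ℤ)) =
        (if (i : ℕ) < k then (b k : ℤ) else 0) • C.arcClass i := by
      intro k
      rw [coord_single, hq]
      split_ifs <;> simp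
    have h2 : ∑ k ∈ Finset.range (g + 1), (if (i : ℕ) < k then (b k : ℤ) else 0) =
        r - (∑ l ∈ Finset.range (i + 1), b l : ℕ) := by
      rw [← hb, ← Finset.sum_range_add_sum_Ico b (show (i : ℕ) + 1 ≤ g + 1 by omega)]
      rw [← Finset.sum_range_add_sum_Ico _ (show (i : ℕ) + 1 ≤ g + 1 by omega)]
      rw [Finset.sum_eq_zero fun k hk => if_neg (by have := Finset.mem_range.mp hk; omega)]
      push_cast
      rw [zero_add, add_sub_cancel_left]
      exact Finset.sum_congr rfl fun k hk => if_pos (by have := Finset.mem_Ico.mp hk; omega)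
    rw [map_sum, Finset.sum_congr rfl fun k _ => h1 k, ← Finset.sum_smul,
      Fin.sum_univ_eq_sum_range (fun k => if (i : ℕ) < k then (b k : ℤ) else 0), h2]
  obtain ⟨c, hc⟩ := hD A hA hA'
  -- The profile of `D - A` starts at `degree D - r`; adding `r` restores the removed chips.
  have := h (fun i => c i + r) (by simp [hc.zero]) (fun k hk => by linarith [hc.anti k hk])
    fun k _ hk => by
      have h1 := hc.stay k (by linarith)
      rw [hcoord, sub_eq_iff_eq_add, ← add_smul] at h1
      rw [h1]
      congr 1
      ring
  simp only [hc.last] at this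
  linarith

/-- `L j i` counts the cycles before `i` at which `low` does not drop in row `j`. It moves by 0 or
1, decreases weakly in `j`, and reaches `s` in every row up to `r`. The symbol `t j k` is the cycle
where it passes from `k` to `k + 1`; there `low` stays and so fixes the coordinate. -/
theorem exists_isTableau_of_rankAtLeast (hg : 0 < g) {D : C.graph.Divisor} {r s : ℕ}
    (hs : (s : ℤ) = g - degree D + r) (hD : RankAtLeast D r) :
    ∃ t : Fin (r + 1) → Fin s → Fin g, IsTableau t ∧
      C.OnTorus (degree D) t fun i => C.coord i D := by
  have hlow := C.low_nonneg_of_rankAtLeast hg hD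
  let p := C.low (degree D) (fun i => C.coord i D)
  let L : ℕ → ℕ → ℤ := fun j i => p i j - degree D + j + i
  have hL0 : ∀ j, L j 0 = 0 := fun j => by simp [L, p, low]
  have hLup : ∀ j i, L j (i + 1) ≤ L j i + 1 := fun j i => by
    have := low_succ_le (C := C) (d := degree D) (x := fun i => C.coord i D) i j
    simp only [L, p]; push_cast; linarith
  have hLmono : ∀ j, Monotone (L j) := fun j => monotone_nat_of_le_succ fun i => by
    have := low_sub_one_le (C := C) (d := degree D) (x := fun i => C.coord i D) i j
    simp only [L, p]; push_cast; linarith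
  have hLanti : ∀ i, Antitone fun j => L j i := fun i => antitone_nat_of_succ_le fun j => by
    have := low_succ_right_le (C := C) (d := degree D) (x := fun i => C.coord i D) i j
    simp only [L, p]; push_cast; linarith
  have hLg : ∀ j ≤ r, (s : ℤ) ≤ L j g := fun j hj => by
    refine le_trans ?_ (hLanti g hj)
    simp only [L, p]
    linarith
  have hex : ∀ (j : Fin (r + 1)) (k : Fin s), ∃ i : Fin g,
      L j i = (k : ℕ) ∧ L j (i + 1) = (k : ℕ) + 1 := by
    intro j k
    obtain ⟨n, hn, h⟩ := exists_lt_and_jump (L j) (hL0 j) (hLup j) (k := (k : ℕ)) (by positivity) g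
      (by have := hLg j (Nat.lt_succ_iff.mp j.2); have := k.2; omega)
    exact ⟨⟨n, hn⟩, h⟩
  choose t ht ht' using hex
  have hx : ∀ j k, C.coord (t j k) D = p (t j k) j • C.arcClass (t j k) := fun j k => by
    refine eq_smul_of_low_succ_eq (x := fun i => C.coord i D) ?_
    have h1 := ht j k
    have h2 := ht' j k
    simp only [L, p] at h1 h2
    push_cast at h2
    linarith
  refine ⟨t, ⟨fun j k k' hk => ?_, fun k => Fin.strictMono_iff_lt_succ.mpr fun j => ?_⟩,
    fun j k => ?_⟩
  · by_contra hle
    have h1 := hLmono j (not_lt.mp hle)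
    rw [ht, ht] at h1
    have := Fin.lt_def.mp hk
    omega
  · have hle : t j.castSucc k ≤ t j.succ k := by
      by_contra hlt
      have h1 := hLmono j.castSucc (Nat.succ_le_of_lt (Fin.lt_def.mp (not_le.mp hlt)))
      have h2 := hLanti (t j.succ k + 1) (show (j.castSucc : ℕ) ≤ j.succ by simp)
      simp only at h2
      rw [ht'] at h2
      rw [ht] at h1
      simp only [Nat.succ_eq_add_one] at h1
      omega
    -- Equal symbols in adjacent rows would equate two consecutive multiples of `arcClass`, which is
    -- nonzero.
    refine lt_of_le_of_ne hle fun heq => C.arcClass_ne_zero (t j.succ k) ?_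
    have h1 := hx j.castSucc k
    have h2 := hx j.succ k
    have h3 := ht j.castSucc k
    have h4 := ht j.succ k
    rw [heq] at h1 h3
    have h5 : p (t j.succ k) j.castSucc = p (t j.succ k) j.succ + 1 := by
      simp only [L] at h3 h4
      simp only [Fin.val_castSucc, Fin.val_succ] at h3 h4 ⊢
      push_cast at h4
      linarith
    rw [h2, h5, add_smul, one_smul] at h1
    exact left_eq_add.mp h1
  · change C.coord (t j k) D = _
    rw [hx]
    congr 1
    have := ht j k
    simp only [L] at this
    linarith

end ChainOfCycles

end Tropical

/-! ### The universal cover and dimension. -/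

namespace Tropical

/-- A coordinate slice of `ℝ ^ ι`, taken modulo a period in each coordinate, has the expected
Hausdorff dimension. -/
theorem dimH_periodic_slice {ι : Type} [Fintype ι] (ℓ : ι → ℝ) (I : Finset ι)
    (z : ∀ i, AddCircle (ℓ i)) :
    dimH {y : ι → ℝ | ∀ i ∈ I, (y i : AddCircle (ℓ i)) = z i} =
      (Fintype.card ι - I.card : ℕ) := by
  classical
  have hz : ∀ i, ∃ a : ℝ, (a : AddCircle (ℓ i)) = z i := fun i => QuotientAddGroup.mk_surjective _
  choose a ha using hz
  -- For each choice of lifts of the fixed coordinates, the slice contains an isometric copy of the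
  -- space of free coordinates. It is the countable union of these.
  let f : (ι → ℤ) → ({i // i ∉ I} → ℝ) → ι → ℝ := fun n v i =>
    if h : i ∈ I then a i + n i • ℓ i else v ⟨i, h⟩
  have hf : ∀ n, Isometry (f n) := by
    intro n
    refine Isometry.of_dist_eq fun u v => le_antisymm ?_ ?_
    · refine (dist_pi_le_iff dist_nonneg).mpr fun i => ?_
      by_cases h : i ∈ I
      · simp only [f, dif_pos h, dist_self]
        exact dist_nonneg
      · simp only [f, dif_neg h]
        exact dist_le_pi_dist u v _
    · refine (dist_pi_le_iff dist_nonneg).mpr fun i => ?_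
      have := dist_le_pi_dist (f n u) (f n v) i
      simpa only [f, dif_neg i.2] using this
  have hset : {y : ι → ℝ | ∀ i ∈ I, (y i : AddCircle (ℓ i)) = z i} =
      ⋃ n, f n '' Set.univ := by
    ext y
    simp only [Set.mem_ofPred_eq, Set.mem_iUnion, Set.image_univ, Set.mem_range]
    constructor
    · intro h
      have h1 : ∀ i, ∃ n : ℤ, i ∈ I → y i = a i + n • ℓ i := by
        intro i
        by_cases hi : i ∈ I
        · have h2 : ((y i - a i : ℝ) : AddCircle (ℓ i)) = 0 := by
            rw [AddCircle.coe_sub, h i hi, ha, sub_self]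
          obtain ⟨n, hn⟩ := (AddCircle.coe_eq_zero_iff (p := ℓ i)).mp h2
          exact ⟨n, fun _ => by rw [hn]; ring⟩
        · exact ⟨0, fun h => absurd h hi⟩
      choose n hn using h1
      refine ⟨n, fun i => y i, funext fun i => ?_⟩
      by_cases hi : i ∈ I
      · simp only [f, dif_pos hi, hn i hi]
      · simp only [f, dif_neg hi]
    · rintro ⟨n, v, rfl⟩ i hi
      simp only [f, dif_pos hi]
      rw [AddCircle.coe_add, AddCircle.coe_zsmul, AddCircle.coe_period, smul_zero, add_zero, ha]
  rw [hset, dimH_iUnion]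
  simp only [(hf _).dimH_image, Real.dimH_univ_pi, iSup_const]
  rw [Fintype.card_subtype_compl, Fintype.card_coe]

namespace MetricGraph

variable {V E : Type} {Γ : MetricGraph V E}

/-- Summation by parts: harmonic forms are orthogonal to coboundaries. Indicator functions of cuts
then give the linear relations below. -/
theorem sum_harmonicForm_mul_eq_zero [Finite V] [Fintype E] (ω : Γ.harmonicForms) (φ : V → ℝ) :
    ∑ e, (ω : E → ℝ) e * (φ (Γ.tgt e) - φ (Γ.src e)) = 0 := by
  classical
  have := Fintype.ofFinite V
  have h1 : ∀ a : E → V, ∑ e, (ω : E → ℝ) e * φ (a e) =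
      ∑ v, φ v * ∑ e, if a e = v then (ω : E → ℝ) e else 0 := by
    intro a
    simp only [Finset.mul_sum]
    rw [Finset.sum_comm]
    refine Finset.sum_congr rfl fun e _ => ?_
    simp [mul_comm]
  simp only [mul_sub, Finset.sum_sub_distrib]
  rw [h1, h1, sub_eq_zero]
  refine Finset.sum_congr rfl fun v _ => ?_
  congr 1
  convert (ω.2 v).symm

end MetricGraph

namespace ChainOfCycles

open MetricGraph

variable {g : ℕ} (C : ChainOfCycles g)

/-- The test function is 0 up to `v i` and 1 from `w i` on, so only the two edges of cycle `i` cross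
the cut. -/
theorem harmonicForm_coarcEdge (ω : C.graph.harmonicForms) (i : Fin g) :
    (ω : C.Edge → ℝ) (C.coarcEdge i) = (ω : C.Edge → ℝ) (C.arcEdge i) := by
  classical
  let φ : C.Vertex → ℝ :=
    C.vertexFun (fun j => if j < i then 0 else 1) (fun j => if j ≤ i then 0 else 1)
  have hw : ∀ j, φ (C.w j) = if j < i then 0 else 1 := fun _ => rfl
  have hv : ∀ j, φ (C.v j) = if j ≤ i then 0 else 1 := fun j => by
    refine C.vertexFun_v _ _ (fun k _ => ?_) j
    simp only [Fin.lt_def, Fin.le_def, Nat.succ_le_iff]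
  have h := sum_harmonicForm_mul_eq_zero ω φ
  have harc : ∀ j, (ω : C.Edge → ℝ) (Sum.inl j) *
      (φ (C.graph.tgt (Sum.inl j)) - φ (C.graph.src (Sum.inl j))) =
        if j = i then (ω : C.Edge → ℝ) (C.arcEdge i) else 0 := by
    intro j
    rw [show C.graph.src (Sum.inl j) = C.v j from rfl,
      show C.graph.tgt (Sum.inl j) = C.w j from rfl, hv, hw]
    rcases lt_trichotomy j i with h | h | h
    · simp [h, h.le, h.ne]
    · subst h; simp
    · simp [h.not_gt, h.not_ge, h.ne']
  have hcoarc : ∀ j, (ω : C.Edge → ℝ) (Sum.inr (Sum.inl j)) *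
      (φ (C.graph.tgt (Sum.inr (Sum.inl j))) - φ (C.graph.src (Sum.inr (Sum.inl j)))) =
        if j = i then - (ω : C.Edge → ℝ) (C.coarcEdge i) else 0 := by
    intro j
    rw [show C.graph.src (Sum.inr (Sum.inl j)) = C.w j from rfl,
      show C.graph.tgt (Sum.inr (Sum.inl j)) = C.v j from rfl, hv, hw]
    rcases lt_trichotomy j i with h | h | h
    · simp [h, h.le, h.ne]
    · subst h; simp
    · simp [h.not_gt, h.not_ge, h.ne']
  have hbridge : ∀ k, (ω : C.Edge → ℝ) (Sum.inr (Sum.inr k)) *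
      (φ (C.graph.tgt (Sum.inr (Sum.inr k))) - φ (C.graph.src (Sum.inr (Sum.inr k)))) = 0 := by
    intro k
    rw [show C.graph.src (Sum.inr (Sum.inr k)) = C.w ⟨k.1, by omega⟩ from rfl,
      show C.graph.tgt (Sum.inr (Sum.inr k)) = C.v ⟨(k.1 : ℕ) + 1, by omega⟩ from rfl, hv, hw]
    simp [Fin.lt_def, Fin.le_def]
  rw [Fintype.sum_sum_type, Fintype.sum_sum_type, Finset.sum_congr rfl fun j _ => harc j,
    Finset.sum_congr rfl fun j _ => hcoarc j, Finset.sum_congr rfl fun k _ => hbridge k] at h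
  simp only [Finset.sum_ite_eq', Finset.mem_univ, if_true, Finset.sum_const_zero, add_zero] at h
  linarith

theorem harmonicForm_bridge (ω : C.graph.harmonicForms) (k : {k : Fin (g - 1) // 0 < C.bridge k}) :
    (ω : C.Edge → ℝ) (Sum.inr (Sum.inr k)) = 0 := by
  classical
  let φ : C.Vertex → ℝ := C.vertexFun (fun j => if (j : ℕ) ≤ k.1 then 0 else 1)
    (fun j => if (j : ℕ) ≤ k.1 then 0 else 1)
  have hw : ∀ j, φ (C.w j) = if (j : ℕ) ≤ k.1 then 0 else 1 := fun _ => rfl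
  have hv : ∀ j, φ (C.v j) = if (j : ℕ) ≤ k.1 then 0 else 1 := fun j => by
    refine C.vertexFun_v _ _ (fun k' hk' => ?_) j
    have hne : (k' : ℕ) ≠ k.1 := fun h => by
      rw [show k' = k.1 from Fin.ext h] at hk'
      exact k.2.ne' hk'
    have : (k' : ℕ) ≤ k.1 ↔ (k' : ℕ) + 1 ≤ k.1 := by omega
    simp only [this]
  have h := sum_harmonicForm_mul_eq_zero ω φ
  have harc : ∀ j, (ω : C.Edge → ℝ) (Sum.inl j) *
      (φ (C.graph.tgt (Sum.inl j)) - φ (C.graph.src (Sum.inl j))) = 0 := by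
    intro j
    rw [show C.graph.src (Sum.inl j) = C.v j from rfl,
      show C.graph.tgt (Sum.inl j) = C.w j from rfl, hv, hw, sub_self, mul_zero]
  have hcoarc : ∀ j, (ω : C.Edge → ℝ) (Sum.inr (Sum.inl j)) *
      (φ (C.graph.tgt (Sum.inr (Sum.inl j))) - φ (C.graph.src (Sum.inr (Sum.inl j)))) = 0 := by
    intro j
    rw [show C.graph.src (Sum.inr (Sum.inl j)) = C.w j from rfl,
      show C.graph.tgt (Sum.inr (Sum.inl j)) = C.v j from rfl, hv, hw, sub_self, mul_zero]
  have hbridge : ∀ k', (ω : C.Edge → ℝ) (Sum.inr (Sum.inr k')) *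
      (φ (C.graph.tgt (Sum.inr (Sum.inr k'))) - φ (C.graph.src (Sum.inr (Sum.inr k')))) =
        if k' = k then (ω : C.Edge → ℝ) (Sum.inr (Sum.inr k)) else 0 := by
    intro k'
    rw [show C.graph.src (Sum.inr (Sum.inr k')) = C.w ⟨k'.1, by omega⟩ from rfl,
      show C.graph.tgt (Sum.inr (Sum.inr k')) = C.v ⟨(k'.1 : ℕ) + 1, by omega⟩ from rfl, hv, hw]
    rcases lt_trichotomy (k'.1 : ℕ) k.1 with h | h | h
    · have : k' ≠ k := fun h' => by subst h'; exact lt_irrefl _ h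
      simp [this, h.le, Nat.succ_le_of_lt h]
    · have : k' = k := Subtype.ext (Fin.ext h)
      subst this
      simp
    · have : k' ≠ k := fun h' => by subst h'; exact lt_irrefl _ h
      have h2 : ¬ (k'.1 : ℕ) + 1 ≤ k.1 := by omega
      simp [this, h.not_ge, h2]
  rw [Fintype.sum_sum_type, Fintype.sum_sum_type, Finset.sum_congr rfl fun j _ => harc j,
    Finset.sum_congr rfl fun j _ => hcoarc j, Finset.sum_congr rfl fun k _ => hbridge k] at h
  simpa using h

/-- The harmonic form with value `y i` on the cycle `i`. -/
noncomputable def cycleForm : (Fin g → ℝ) →ₗ[ℝ] C.graph.harmonicForms where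
  toFun y := ⟨Sum.elim y (Sum.elim y 0), by
    intro v
    rw [Fintype.sum_sum_type, Fintype.sum_sum_type, Fintype.sum_sum_type, Fintype.sum_sum_type]
    simp only [Sum.elim_inl, Sum.elim_inr, Pi.zero_apply, ite_self, Finset.sum_const_zero,
      add_zero]
    exact add_comm _ _⟩
  map_add' y y' := by
    ext (i | i | k) <;> simp
  map_smul' a y := by
    ext (i | i | k) <;> simp

theorem cycleForm_coe (y : Fin g → ℝ) :
    (C.cycleForm y : C.Edge → ℝ) = Sum.elim y (Sum.elim y 0) := rfl

theorem harmonicForm_eq_cycleForm (ω : C.graph.harmonicForms) :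
    ω = C.cycleForm fun i => (ω : C.Edge → ℝ) (C.arcEdge i) := by
  ext (i | i | k)
  · rfl
  · exact C.harmonicForm_coarcEdge ω i
  · exact C.harmonicForm_bridge ω k

/-- The space of harmonic forms has the cycles as a basis. -/
noncomputable def cycleFormEquiv : (Fin g → ℝ) ≃ₗ[ℝ] C.graph.harmonicForms :=
  LinearEquiv.ofBijective C.cycleForm ⟨fun y y' h => by
    funext i
    exact congrFun (congrArg Subtype.val h) (C.arcEdge i),
    fun ω => ⟨_, (C.harmonicForm_eq_cycleForm ω).symm⟩⟩

/-- The coordinates on the universal cover of `Pic^d`. -/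
noncomputable def coverCoordsLinear : (C.graph.harmonicForms →L[ℝ] ℝ) ≃ₗ[ℝ] (Fin g → ℝ) :=
  (LinearMap.toContinuousLinearMap (𝕜 := ℝ) (E := C.graph.harmonicForms) (F' := ℝ)).symm ≪≫ₗ
    C.cycleFormEquiv.symm.congrLeft ℝ ℝ ≪≫ₗ LinearEquiv.piRing ℝ ℝ (Fin g) ℝ

/-- The coordinates on the universal cover of `Pic^d`, as a homeomorphism. -/
noncomputable def coverCoords : (C.graph.harmonicForms →L[ℝ] ℝ) ≃L[ℝ] (Fin g → ℝ) :=
  LinearEquiv.toContinuousLinearEquiv (𝕜 := ℝ) (E := C.graph.harmonicForms →L[ℝ] ℝ)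
    (F := Fin g → ℝ) C.coverCoordsLinear

theorem dimH_preimage_coverCoords (Y : Set (Fin g → ℝ)) :
    dimH (C.coverCoords ⁻¹' Y) = dimH Y :=
  ContinuousLinearEquiv.dimH_preimage (𝕜 := ℝ) (E := C.graph.harmonicForms →L[ℝ] ℝ)
    (F := Fin g → ℝ) C.coverCoords Y

theorem coverCoords_apply (χ : C.graph.harmonicForms →L[ℝ] ℝ) (i : Fin g) :
    C.coverCoords χ i = χ (C.cycleForm (Pi.single i 1)) := rfl

theorem apply_eq_sum_coverCoords (χ : C.graph.harmonicForms →L[ℝ] ℝ) (ω : C.graph.harmonicForms) :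
    χ ω = ∑ i, (ω : C.Edge → ℝ) (C.arcEdge i) * C.coverCoords χ i := by
  conv_lhs => rw [C.harmonicForm_eq_cycleForm ω, pi_eq_sum_univ' fun i =>
    (ω : C.Edge → ℝ) (C.arcEdge i), map_sum, map_sum]
  refine Finset.sum_congr rfl fun i _ => ?_
  rw [map_smul, map_smul, coverCoords_apply, smul_eq_mul]

theorem sum_harmonicForm_mul (ω : C.graph.harmonicForms) (δ : C.Edge → ℝ) :
    ∑ e, (ω : C.Edge → ℝ) e * δ e =
      ∑ i, (ω : C.Edge → ℝ) (C.arcEdge i) * (δ (C.arcEdge i) + δ (C.coarcEdge i)) := by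
  rw [Fintype.sum_sum_type, Fintype.sum_sum_type, Finset.sum_congr rfl fun i _ =>
    congrArg (· * δ (C.coarcEdge i)) (C.harmonicForm_coarcEdge ω i), Finset.sum_congr rfl fun k _ =>
    congrArg (· * δ (Sum.inr (Sum.inr k))) (C.harmonicForm_bridge ω k)]
  simp [mul_add, Finset.sum_add_distrib]

/-- A harmonic form is constant around each cycle and zero on bridges, so its integral sees only the
total increment around each cycle. -/
theorem forall_apply_eq_sum_iff (χ : C.graph.harmonicForms →L[ℝ] ℝ) (δ : C.Edge → ℝ) :
    (∀ ω : C.graph.harmonicForms, χ ω = ∑ e, (ω : C.Edge → ℝ) e * δ e) ↔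
      ∀ i, δ (C.arcEdge i) + δ (C.coarcEdge i) = C.coverCoords χ i := by
  constructor
  · intro h i
    rw [coverCoords_apply, h, sum_harmonicForm_mul, Finset.sum_eq_single i]
    · simp [cycleForm_coe]
    · intro j _ hj
      simp [cycleForm_coe, hj]
    · simp
  · intro h ω
    rw [apply_eq_sum_coverCoords, sum_harmonicForm_mul]
    simp only [h]

theorem mem_univCoverLift_iff (hg : 0 < g) (D₀ : C.graph.Divisor) (S : Set C.graph.Pic)
    (χ : C.graph.harmonicForms →L[ℝ] ℝ) :
    χ ∈ C.graph.univCoverLift D₀ S ↔ ∃ D : C.graph.Divisor, cls D ∈ S ∧ degree D = degree D₀ ∧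
      ∀ i, C.coord i D = C.coord i D₀ + (C.coverCoords χ i : AddCircle (C.cycleLength i)) := by
  refine exists_congr fun D => and_congr_right fun _ => ?_
  -- The boundary convention in `univCoverLift` carries a minus sign, hence `D₀ - D`.
  have h := C.exists_mem_ordIncrement_iff hg (D₀ - D) (C.coverCoords χ)
  rw [map_sub, sub_eq_zero, degreeHom_apply, degreeHom_apply, eq_comm (a := degree D₀)] at h
  have h2 : ∀ i, C.coord i (D₀ - D) = -(C.coverCoords χ i : AddCircle (C.cycleLength i)) ↔
      C.coord i D = C.coord i D₀ + (C.coverCoords χ i : AddCircle (C.cycleLength i)) := fun i => by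
    rw [map_sub, ← neg_sub, neg_inj, sub_eq_iff_eq_add, add_comm]
  simp only [h2] at h
  rw [← h]
  simp only [← C.forall_apply_eq_sum_iff]
  constructor
  · rintro ⟨F, hF, hχ⟩
    refine ⟨fun e => F.val e (C.graph.len e) - F.val e 0, ⟨F, fun p => ?_, fun e => rfl⟩, hχ⟩
    have := hF p
    rw [Finsupp.sub_apply] at this ⊢
    linarith
  · rintro ⟨δ, ⟨F, hF, hδ⟩, hχ⟩
    refine ⟨F, fun p => ?_, fun ω => ?_⟩
    · have := hF p
      rw [Finsupp.sub_apply] at this ⊢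
      linarith
    · rw [hχ]
      exact Finset.sum_congr rfl fun e _ => congrArg _ (hδ e)

/-- The preimage of the torus attached to `t` in `ℝ ^ g`, with the coordinates of `D₀` as
origin. -/
def torusLift (D₀ : C.graph.Divisor) {m s : ℕ} (t : Fin m → Fin s → Fin g) : Set (Fin g → ℝ) :=
  {y | C.OnTorus (degree D₀) t fun i => C.coord i D₀ + (y i : AddCircle (C.cycleLength i))}

theorem mem_torusLift {D₀ : C.graph.Divisor} {m s : ℕ} {t : Fin m → Fin s → Fin g}
    {y : Fin g → ℝ} : y ∈ C.torusLift D₀ t ↔ C.OnTorus (degree D₀) t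
      fun i => C.coord i D₀ + (y i : AddCircle (C.cycleLength i)) := Iff.rfl

/-- The symbols used by a filling. -/
def symbols {m s : ℕ} (t : Fin m → Fin s → Fin g) : Finset (Fin g) :=
  Finset.univ.image fun p : Fin m × Fin s => t p.1 p.2

theorem mem_symbols {m s : ℕ} (t : Fin m → Fin s → Fin g) (j : Fin m) (k : Fin s) :
    t j k ∈ symbols t :=
  Finset.mem_image.mpr ⟨(j, k), Finset.mem_univ _, rfl⟩

/-- Once one point satisfies all conditions, repeated symbols impose the same condition, so each
distinct symbol fixes one coordinate. -/
theorem dimH_torusLift (D₀ : C.graph.Divisor) {m s : ℕ} {t : Fin m → Fin s → Fin g}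
    (h : (C.torusLift D₀ t).Nonempty) :
    dimH (C.torusLift D₀ t) = (g - (symbols t).card : ℕ) := by
  obtain ⟨y₀, hy₀⟩ := h
  have : C.torusLift D₀ t = {y | ∀ i ∈ symbols t,
      (y i : AddCircle (C.cycleLength i)) = (y₀ i : AddCircle (C.cycleLength i))} := by
    ext y
    constructor
    · intro hy i hi
      obtain ⟨⟨j, k⟩, -, rfl⟩ := Finset.mem_image.mp hi
      exact add_left_cancel ((hy j k).trans (hy₀ j k).symm)
    · intro hy j k
      have := hy _ (mem_symbols t j k)
      simp only [this]
      exact hy₀ j k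
  rw [this, dimH_periodic_slice, Fintype.card_fin]

theorem univCoverLift_brillNoetherLocus (hg : 0 < g) (D₀ : C.graph.Divisor) {r s : ℕ}
    (hs : (s : ℤ) = g - degree D₀ + r) :
    C.graph.univCoverLift D₀ (C.graph.brillNoetherLocus r (degree D₀)) = C.coverCoords ⁻¹'
      ⋃ t : {t : Fin (r + 1) → Fin s → Fin g // IsTableau t}, C.torusLift D₀ t.1 := by
  ext χ
  rw [C.mem_univCoverLift_iff hg, Set.mem_preimage, Set.mem_iUnion]
  constructor
  · rintro ⟨D, ⟨D', hD', hr, hcls⟩, hdeg, hcoord⟩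
    obtain ⟨-, hcoord'⟩ := (C.cls_eq_cls_iff hg).mp hcls
    obtain ⟨t, ht, hx⟩ := C.exists_isTableau_of_rankAtLeast hg (by rw [hs, hD']) hr
    refine ⟨⟨t, ht⟩, ?_⟩
    rw [hD'] at hx
    rw [mem_torusLift]
    simpa only [← hcoord, ← hcoord'] using hx
  · rintro ⟨⟨t, ht⟩, hx⟩
    obtain ⟨D, hD, hcoord⟩ := C.exists_divisor hg (degree D₀) fun i =>
      C.coord i D₀ + (C.coverCoords χ i : AddCircle (C.cycleLength i))
    refine ⟨D, ⟨D, hD, ?_, rfl⟩, hD, hcoord⟩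
    refine C.rankAtLeast_of_isTableau hg (by rw [hs, hD]) ht ?_
    simp only [hcoord, hD]
    exact hx

theorem dimH_univCoverLift_brillNoetherLocus (hg : 0 < g) (D₀ : C.graph.Divisor) {r s : ℕ}
    (hs : (s : ℤ) = g - degree D₀ + r) :
    dimH (C.graph.univCoverLift D₀ (C.graph.brillNoetherLocus r (degree D₀))) =
      ⨆ t : {t : Fin (r + 1) → Fin s → Fin g // IsTableau t}, dimH (C.torusLift D₀ t.1) := by
  rw [C.univCoverLift_brillNoetherLocus hg D₀ hs, dimH_preimage_coverCoords, dimH_iUnion]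

theorem brillNoetherLocus_nonempty_iff (hg : 0 < g) {d : ℤ} {r s : ℕ} (hs : (s : ℤ) = g - d + r) :
    (C.graph.brillNoetherLocus r d).Nonempty ↔ ∃ (t : Fin (r + 1) → Fin s → Fin g)
      (x : ∀ i, AddCircle (C.cycleLength i)), IsTableau t ∧ C.OnTorus d t x := by
  constructor
  · rintro ⟨_, D, rfl, hr, -⟩
    obtain ⟨t, ht, hx⟩ := C.exists_isTableau_of_rankAtLeast hg hs hr
    exact ⟨t, _, ht, hx⟩
  · rintro ⟨t, x, ht, hx⟩
    obtain ⟨D, rfl, hD⟩ := C.exists_divisor hg d x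
    refine ⟨cls D, D, rfl, C.rankAtLeast_of_isTableau hg hs ht ?_, rfl⟩
    simpa only [hD] using hx

theorem torusLift_nonempty (D₀ : C.graph.Divisor) {m s : ℕ} {t : Fin m → Fin s → Fin g}
    {x : ∀ i, AddCircle (C.cycleLength i)} (hx : C.OnTorus (degree D₀) t x) :
    (C.torusLift D₀ t).Nonempty := by
  have : ∀ i, ∃ y : ℝ, (y : AddCircle (C.cycleLength i)) = x i - C.coord i D₀ :=
    fun i => QuotientAddGroup.mk_surjective _
  choose y hy using this
  refine ⟨y, ?_⟩
  rw [mem_torusLift]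
  simpa only [hy, add_sub_cancel] using hx

/-- A bridge of length 0 removes one vertex and one edge. -/
theorem genus_graph (hg : 0 < g) : C.graph.genus = g := by
  classical
  have hm : Fintype.card {i : Fin g // C.Merged i} =
      Fintype.card {k : Fin (g - 1) // ¬ 0 < C.bridge k} := by
    symm
    refine Fintype.card_congr (Equiv.ofBijective
      (fun k => ⟨⟨(k.1 : ℕ) + 1, by omega⟩, C.merged_succ.mpr
        (le_antisymm (not_lt.mp k.2) (C.bridge_nonneg _))⟩) ⟨?_, ?_⟩)
    · intro k k' h
      have := congrArg (fun i => (i.1 : ℕ)) h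
      exact Subtype.ext (Fin.ext (by simpa using this))
    · rintro ⟨i, k, hk, hk'⟩
      exact ⟨⟨k, hk'.not_gt⟩, Subtype.ext (Fin.ext hk)⟩
  have h1 := Fintype.card_subtype_compl fun i : Fin g => C.Merged i
  have h2 := Fintype.card_subtype_compl fun k : Fin (g - 1) => 0 < C.bridge k
  have h3 := Fintype.card_subtype_le fun i : Fin g => C.Merged i
  have h4 := Fintype.card_subtype_le fun k : Fin (g - 1) => 0 < C.bridge k
  rw [Fintype.card_fin] at h1 h2 h3 h4
  rw [genus, Nat.card_eq_fintype_card, Nat.card_eq_fintype_card, Fintype.card_sum,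
    Fintype.card_sum, Fintype.card_sum, Fintype.card_fin]
  omega

end ChainOfCycles

end Tropical

/-! ### Repeated symbols and torsion. -/

namespace Tropical

section Repetition

variable {m s g : ℕ}

/-- The diagonal of a cell of a rectangle. -/
def content (p : Fin m × Fin s) : ℤ := (p.2 : ℕ) - (p.1 : ℕ)

/-- If a symbol of a tableau is repeated at content difference `n`, and no symbol is repeated at a
smaller one, then there are `n - 1` symbols before and `n - 1` symbols after it. -/
theorem IsTableau.le_of_minimal_repetition {t : Fin m → Fin s → Fin g} (ht : IsTableau t) {n : ℤ}
    (hmin : ∀ p q : Fin m × Fin s, p ≠ q → t p.1 p.2 = t q.1 q.2 → n ≤ |content p - content q|)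
    {j j' : Fin m} {k k' : Fin s} (hj : j < j') (hk : k' < k) (heq : t j k = t j' k')
    (hn : n = content (j, k) - content (j', k')) : n ≤ t j k + 1 ∧ n ≤ g - t j k := by
  have hj0 := Fin.lt_def.mp hj
  have hk0 := Fin.lt_def.mp hk
  -- Cells with content strictly between those of the repeated pair differ in content by less than
  -- `n`, so by minimality they carry distinct symbols.
  have hinj : ∀ H : Finset (Fin m × Fin s),
      (∀ p ∈ H, content (j', k') < content p ∧ content p < content (j, k)) →
        Set.InjOn (fun p : Fin m × Fin s => t p.1 p.2) (H : Set (Fin m × Fin s)) := by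
    intro H hH p hp q hq h
    by_contra hpq
    have h1 := hmin p q hpq h
    have h2 := hH p hp
    have h3 := hH q hq
    rcases abs_cases (content p - content q) with h4 | h4 <;> omega
  simp only [content] at hn hinj
  constructor
  · let H : Finset (Fin m × Fin s) := ({j} ×ˢ Finset.Ico k' k) ∪ (Finset.Ioo j j' ×ˢ {k'})
    have hH : H.card = (k - k' : ℕ) + (j' - j - 1 : ℕ) := by
      rw [Finset.card_union_of_disjoint, Finset.card_product, Finset.card_product, Fin.card_Ico,
        Fin.card_Ioo, Finset.card_singleton, Finset.card_singleton, one_mul, mul_one]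
      rw [Finset.disjoint_left]
      intro p hp hp'
      simp only [Finset.mem_product, Finset.mem_singleton, Finset.mem_Ioo] at hp hp'
      exact hp'.1.1.ne' hp.1
    have hcard : H.card ≤ (Finset.Iio (t j k)).card := by
      refine Finset.card_le_card_of_injOn (fun p => t p.1 p.2) ?_ (hinj H ?_)
      · intro p hp
        simp only [H, Finset.coe_union, Set.mem_union, Finset.mem_coe, Finset.mem_product,
          Finset.mem_singleton, Finset.mem_Ioo, Finset.mem_Ico] at hp
        rw [Finset.mem_coe, Finset.mem_Iio]
        change t p.1 p.2 < t j k
        rcases hp with ⟨h1, h2, h3⟩ | ⟨⟨h1, h2⟩, h3⟩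
        · rw [h1]
          exact ht.row j h3
        · rw [h3, heq]
          exact ht.col k' h2
      · intro p hp
        simp only [H, Finset.mem_union, Finset.mem_product,
          Finset.mem_singleton, Finset.mem_Ioo, Finset.mem_Ico, Fin.lt_def, Fin.le_def,
          Fin.ext_iff] at hp
        omega
    rw [hH, Fin.card_Iio] at hcard
    omega
  · let H : Finset (Fin m × Fin s) := ({j'} ×ˢ Finset.Ioc k' k) ∪ (Finset.Ioo j j' ×ˢ {k})
    have hH : H.card = (k - k' : ℕ) + (j' - j - 1 : ℕ) := by
      rw [Finset.card_union_of_disjoint, Finset.card_product, Finset.card_product, Fin.card_Ioc,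
        Fin.card_Ioo, Finset.card_singleton, Finset.card_singleton, one_mul, mul_one]
      rw [Finset.disjoint_left]
      intro p hp hp'
      simp only [Finset.mem_product, Finset.mem_singleton, Finset.mem_Ioo] at hp hp'
      exact hp'.1.2.ne hp.1
    have hcard : H.card ≤ (Finset.Ioi (t j k)).card := by
      refine Finset.card_le_card_of_injOn (fun p => t p.1 p.2) ?_ (hinj H ?_)
      · intro p hp
        simp only [H, Finset.coe_union, Set.mem_union, Finset.mem_coe, Finset.mem_product,
          Finset.mem_singleton, Finset.mem_Ioo, Finset.mem_Ioc] at hp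
        rw [Finset.mem_coe, Finset.mem_Ioi]
        change t j k < t p.1 p.2
        rcases hp with ⟨h1, h2, h3⟩ | ⟨⟨h1, h2⟩, h3⟩
        · rw [h1, heq]
          exact ht.row j' h2
        · rw [h3]
          exact ht.col k h1
      · intro p hp
        simp only [H, Finset.mem_union, Finset.mem_product,
          Finset.mem_singleton, Finset.mem_Ioo, Finset.mem_Ioc, Fin.lt_def, Fin.le_def,
          Fin.ext_iff] at hp
        omega
    rw [hH, Fin.card_Ioi] at hcard
    have := (t j k).2
    omega

/-- Two cells with the same symbol are not comparable. -/
theorem IsTableau.lt_and_lt_of_eq {t : Fin m → Fin s → Fin g} (ht : IsTableau t)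
    {p q : Fin m × Fin s} (hpq : p ≠ q) (h : t p.1 p.2 = t q.1 q.2) :
    (p.1 < q.1 ∧ q.2 < p.2) ∨ (q.1 < p.1 ∧ p.2 < q.2) := by
  have hle : ∀ {p q : Fin m × Fin s}, p.1 < q.1 → t p.1 p.2 = t q.1 q.2 → q.2 < p.2 := by
    intro p q h1 h2
    by_contra h3
    have h4 : t p.1 p.2 < t q.1 p.2 := ht.col p.2 h1
    exact (h4.trans_le ((ht.row q.1).monotone (not_lt.mp h3))).ne h2
  rcases lt_trichotomy p.1 q.1 with h1 | h1 | h1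
  · exact Or.inl ⟨h1, hle h1 h⟩
  · rw [h1] at h
    exact absurd (Prod.ext h1 ((ht.row q.1).injective h)) hpq
  · exact Or.inr ⟨h1, hle h1 h.symm⟩

end Repetition

namespace ChainOfCycles

open MetricGraph

variable {g : ℕ} (C : ChainOfCycles g)

/-- If all torsion orders are large, then a tableau with nonempty torus has no repeated symbol. -/
theorem OnTorus.eq_of_eq_symbol {C : ChainOfCycles g}
    (hC : ∀ (i : Fin g) (n : ℕ), 0 < n → n • C.arcClass i = 0 → min ((i : ℕ) + 1) (g - i) < n)
    {d : ℤ} {m s : ℕ} {t : Fin m → Fin s → Fin g} {x : ∀ i, AddCircle (C.cycleLength i)}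
    (hx : C.OnTorus d t x) (ht : IsTableau t) {p q : Fin m × Fin s}
    (h : t p.1 p.2 = t q.1 q.2) : p = q := by
  -- Strong induction on the content difference makes every repetition considered a minimal one.
  have key : ∀ (n : ℕ) (p q : Fin m × Fin s), p.1 < q.1 → q.2 < p.2 →
      t p.1 p.2 = t q.1 q.2 → content p - content q ≠ n := by
    intro n
    induction n using Nat.strong_induction_on with
    | _ n ih =>
      rintro ⟨j, k⟩ ⟨j', k'⟩ hj hk heq hn
      simp only at hj hk heq
      have hj0 := Fin.lt_def.mp hj
      have hk0 := Fin.lt_def.mp hk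
      have hmin : ∀ p q : Fin m × Fin s, p ≠ q → t p.1 p.2 = t q.1 q.2 →
          (n : ℤ) ≤ |content p - content q| := by
        intro p q hpq h
        by_contra hlt
        rcases ht.lt_and_lt_of_eq hpq h with ⟨h1, h2⟩ | ⟨h1, h2⟩
        · have h3 := Fin.lt_def.mp h1
          have h4 := Fin.lt_def.mp h2
          have h5 : 0 ≤ content p - content q := by simp only [content]; omega
          rw [abs_of_nonneg h5] at hlt
          exact ih (content p - content q).toNat (by omega) p q h1 h2 h (by omega)
        · have h3 := Fin.lt_def.mp h1
          have h4 := Fin.lt_def.mp h2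
          have h5 : 0 ≤ content q - content p := by simp only [content]; omega
          rw [abs_sub_comm, abs_of_nonneg h5] at hlt
          exact ih (content q - content p).toNat (by omega) q p h1 h2 h.symm (by omega)
      obtain ⟨h1, h2⟩ := ht.le_of_minimal_repetition hmin hj hk heq hn.symm
      have h3 : 0 < n := by simp only [content] at hn; omega
      -- The difference of the two torus conditions on the same coordinate.
      have h4 : n • C.arcClass (t j k) = 0 := by
        have h5 := hx j k
        rw [hx.eq_of_eq heq.symm, ← sub_eq_zero, ← sub_smul] at h5
        rw [← natCast_zsmul, ← neg_eq_zero, ← neg_smul]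
        convert h5 using 2
        simp only [content] at hn
        omega
      have := hC _ n h3 h4
      have := (t j k).2
      omega
  by_contra hpq
  rcases ht.lt_and_lt_of_eq hpq h with ⟨h1, h2⟩ | ⟨h1, h2⟩
  · have h3 := Fin.lt_def.mp h1
    have h4 := Fin.lt_def.mp h2
    exact key (content p - content q).toNat p q h1 h2 h (by simp only [content]; omega)
  · have h3 := Fin.lt_def.mp h1
    have h4 := Fin.lt_def.mp h2
    exact key (content q - content p).toNat q p h1 h2 h.symm (by simp only [content]; omega)

theorem nsmul_arcClass_eq_zero_iff (i : Fin g) (n : ℕ) :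
    n • C.arcClass i = 0 ↔ ∃ k : ℤ, (n : ℝ) * C.arc i = k * C.cycleLength i := by
  rw [← AddCircle.coe_nsmul, AddCircle.coe_eq_zero_iff]
  refine exists_congr fun k => ?_
  rw [zsmul_eq_mul, nsmul_eq_mul, eq_comm]

theorem torsionOrder_nsmul (i : Fin g) (h : C.torsionOrder i ≠ 0) :
    C.torsionOrder i • C.arcClass i = 0 := by
  rw [nsmul_arcClass_eq_zero_iff]
  have hirr : ¬ Irrational (C.arc i / C.cycleLength i) := fun h' => h (if_pos h')
  rw [torsionOrder, if_neg hirr] at h ⊢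
  -- The infimum of the empty set is 0, so a nonzero value is attained.
  exact (Nat.sInf_mem (Nat.nonempty_of_pos_sInf (Nat.pos_of_ne_zero h))).2

theorem torsionOrder_of_nsmul {i : Fin g} {n : ℕ} (hn : 0 < n) (h : n • C.arcClass i = 0) :
    C.torsionOrder i ≠ 0 ∧ C.torsionOrder i ≤ n := by
  obtain ⟨k, hk⟩ := (C.nsmul_arcClass_eq_zero_iff i n).mp h
  have hl := (C.cycleLength_pos i).ne'
  have hn' : (n : ℝ) ≠ 0 := by positivity
  have hirr : ¬ Irrational (C.arc i / C.cycleLength i) := by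
    rw [irrational_iff_ne_rational]
    push Not
    refine ⟨k, n, by exact_mod_cast hn.ne', ?_⟩
    push_cast
    rw [div_eq_div_iff hl hn', mul_comm, hk]
  rw [torsionOrder, if_neg hirr]
  have hmem : n ∈ {m : ℕ | 0 < m ∧ ∃ k : ℤ, (m : ℝ) * C.arc i = k * C.cycleLength i} :=
    ⟨hn, k, hk⟩
  exact ⟨(Nat.sInf_mem ⟨n, hmem⟩).1.ne', Nat.sInf_le hmem⟩

theorem two_le_of_nsmul {i : Fin g} {n : ℕ} (hn : 0 < n) (h : n • C.arcClass i = 0) : 2 ≤ n := by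
  by_contra hlt
  obtain rfl : n = 1 := by omega
  exact C.arcClass_ne_zero i (by simpa using h)

/-- Every nonempty torus comes from a tableau with `(r + 1) * s` distinct symbols, so it has
dimension `ρ`, and none exists if `ρ < 0`. If `ρ ≥ 0`, filling the rectangle row by row with
distinct symbols gives a nonempty torus. -/
theorem isBrillNoetherGeneral_of_torsion (hg : 0 < g)
    (hC : ∀ (i : Fin g) (n : ℕ), 0 < n → n • C.arcClass i = 0 → min ((i : ℕ) + 1) (g - i) < n) :
    C.graph.IsBrillNoetherGeneral := by
  have hcard : ∀ {d : ℤ} {r s : ℕ} {t : Fin (r + 1) → Fin s → Fin g}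
      {x : ∀ i, AddCircle (C.cycleLength i)}, IsTableau t → C.OnTorus d t x →
      (symbols t).card = (r + 1) * s := by
    intro d r s t x ht hx
    rw [symbols, Finset.card_image_of_injective _ fun p q h => hx.eq_of_eq_symbol hC ht h]
    simp
  have hcard_le : ∀ {m s : ℕ} (t : Fin m → Fin s → Fin g), (symbols t).card ≤ g := fun t => by
    simpa using Finset.card_le_univ (symbols t)
  intro r d hrd
  rw [C.genus_graph hg] at hrd ⊢
  obtain ⟨s, hs⟩ := Int.eq_ofNat_of_zero_le hrd
  rw [hs]
  constructor
  · intro n hn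
    have hle : (r + 1) * s ≤ g := by
      have : (0 : ℤ) ≤ g - (r + 1) * s := by rw [← hn]; positivity
      have : ((r + 1 : ℕ) : ℤ) * s ≤ g := by push_cast; linarith
      exact_mod_cast this
    have hn' : n = g - (r + 1) * s := by
      zify [hle]
      exact hn
    have hlt : ∀ (j : Fin (r + 1)) (k : Fin s), (j : ℕ) * s + k < g := fun j k => by
      have h1 : ((j : ℕ) + 1) * s ≤ (r + 1) * s := Nat.mul_le_mul_right s (Nat.succ_le_of_lt j.2)
      have h2 := k.2
      rw [Nat.add_one_mul] at h1
      omega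
    let t : Fin (r + 1) → Fin s → Fin g := fun j k => ⟨j * s + k, hlt j k⟩
    have ht : IsTableau t := by
      refine ⟨fun j k k' h => ?_, fun k j j' h => ?_⟩
      · have := Fin.lt_def.mp h
        simp only [t, Fin.mk_lt_mk]
        omega
      · have h1 := Fin.lt_def.mp h
        have h2 := k.2
        simp only [t, Fin.mk_lt_mk]
        exact Nat.add_lt_add_right (Nat.mul_lt_mul_of_pos_right h1 (by omega)) _
    have hx : ∃ x : ∀ i, AddCircle (C.cycleLength i), C.OnTorus d t x := by
      refine ⟨fun i => (d - (i : ℕ) + (i % s : ℕ) - (i / s : ℕ)) • C.arcClass i, fun j k => ?_⟩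
      have h1 : (t j k : ℕ) / s = j := by
        simp only [t]
        rw [add_comm, Nat.add_mul_div_right _ _ (by have := k.2; omega),
          Nat.div_eq_of_lt k.2, zero_add]
      have h2 : (t j k : ℕ) % s = k := by
        simp only [t]
        rw [add_comm, Nat.add_mul_mod_self_right, Nat.mod_eq_of_lt k.2]
      simp only [h1, h2]
    obtain ⟨x, hx⟩ := hx
    refine ⟨(C.brillNoetherLocus_nonempty_iff hg hs.symm).mpr ⟨t, x, ht, hx⟩, fun D₀ hD₀ => ?_⟩
    subst hD₀
    rw [C.dimH_univCoverLift_brillNoetherLocus hg D₀ hs.symm]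
    refine le_antisymm (iSup_le fun t' => ?_) (le_iSup_of_le ⟨t, ht⟩ ?_)
    · rcases (C.torusLift D₀ t'.1).eq_empty_or_nonempty with h | h
      · rw [h, dimH_empty]
        exact zero_le
      · rw [C.dimH_torusLift D₀ h]
        obtain ⟨y, hy⟩ := h
        rw [hcard t'.2 (C.mem_torusLift.mp hy), hn']
    · rw [C.dimH_torusLift D₀ (C.torusLift_nonempty D₀ hx), hcard ht hx, hn']
  · intro hneg
    rw [← Set.not_nonempty_iff_eq_empty, C.brillNoetherLocus_nonempty_iff hg hs.symm]
    rintro ⟨t, x, ht, hx⟩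
    have h1 := hcard_le t
    rw [hcard ht hx] at h1
    have : ((r + 1 : ℕ) : ℤ) * s ≤ g := by exact_mod_cast h1
    push_cast at this
    linarith

/-- The tableau of shape `2 × m` in which the symbol `i` occurs twice. -/
theorem exists_isTableau_repetition {i : Fin g} {m : ℕ} (hm : 2 ≤ m) (h1 : m ≤ (i : ℕ) + 1)
    (h2 : m ≤ g - i) : ∃ t : Fin 2 → Fin m → Fin g, IsTableau t ∧ (symbols t).card < 2 * m ∧
      ∀ d (C : ChainOfCycles g), m • C.arcClass i = 0 → ∃ x, C.OnTorus d t x := by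
  have hi := i.2
  -- The rows are `0, …, m - 2, i` and `i, …, i + m - 1`. The two cells with `i` have content
  -- difference `m`.
  let a : Fin 2 → Fin m → ℕ := fun j k => if j = 0 then (if (k : ℕ) + 1 = m then i else k) else i + k
  have ha : ∀ j k, a j k < g := fun j k => by
    have := k.2
    simp only [a]
    split_ifs <;> omega
  let t : Fin 2 → Fin m → Fin g := fun j k => ⟨a j k, ha j k⟩
  have h0 : t 0 ⟨m - 1, by omega⟩ = t 1 ⟨0, by omega⟩ := by
    simp only [t, a, Fin.mk.injEq]
    simp
    omega
  refine ⟨t, ⟨fun j k k' h => ?_, fun k j j' h => ?_⟩, ?_, fun d C hC => ?_⟩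
  · have := Fin.lt_def.mp h
    have := k'.2
    simp only [t, a, Fin.mk_lt_mk]
    split_ifs <;> omega
  · have h3 := Fin.lt_def.mp h
    have h4 : j = 0 := by omega
    have h5 : j' ≠ 0 := by omega
    have := k.2
    simp only [t, a, Fin.mk_lt_mk, if_pos h4, if_neg h5]
    split_ifs <;> omega
  · have h3 : (symbols t).card ≤ (Finset.univ : Finset (Fin 2 × Fin m)).card :=
      Finset.card_image_le
    have h4 : (Finset.univ : Finset (Fin 2 × Fin m)).card = 2 * m := by simp
    rw [h4] at h3
    refine lt_of_le_of_ne h3 fun h5 => ?_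
    rw [← h4] at h5
    have h6 : ((0, ⟨m - 1, by omega⟩) : Fin 2 × Fin m) = (1, ⟨0, by omega⟩) :=
      Finset.card_image_iff.mp h5 (by simp) (by simp) h0
    simp at h6
  -- Symbols below `i` take their condition from the first row, all others from the second. At `i`
  -- the first row asks for a value differing by `m • arcClass i = 0`.
  · refine ⟨fun i' => (if (i' : ℕ) < i then d - (i' : ℕ) + (i' : ℕ) - 0 else
      d - (i' : ℕ) + ((i' : ℕ) - (i : ℕ)) - 1) • C.arcClass i', fun j k => ?_⟩
    have hk := k.2
    by_cases hj : j = 0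
    · subst hj
      by_cases hkm : (k : ℕ) + 1 = m
      · have h3 : t 0 k = i := by
          refine Fin.ext ?_
          simp [t, a, hkm]
        have h4 : m • C.arcClass (t 0 k) = 0 := by
          have : ∀ i', i' = i → m • C.arcClass i' = 0 := by
            rintro _ rfl
            exact hC
          exact this _ h3
        have h5 : (t 0 k : ℕ) = i := congrArg _ h3
        have h6 : ¬ (t 0 k : ℕ) < i := by omega
        simp only [if_neg h6]
        rw [← sub_eq_zero, ← sub_smul]
        rw [← natCast_zsmul, ← neg_eq_zero, ← neg_smul] at h4
        convert h4 using 2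
        simp
        omega
      · have h3 : (t 0 k : ℕ) = k := by
          simp [t, a, hkm]
        have h4 : (t 0 k : ℕ) < i := by omega
        simp only [if_pos h4]
        congr 1
        simp
        omega
    · have h3 : (t j k : ℕ) = i + k := by
        simp [t, a, hj]
      have h4 : ¬ (t j k : ℕ) < i := by omega
      have h5 : (j : ℕ) = 1 := by omega
      simp only [if_neg h4, h5]
      congr 1
      omega

/-- Take `r = 1` and `d = g + 1 - m`, so that the shape is `2 × m` and `ρ = g - 2 * m`. A torus with
fewer than `2 * m` symbols is too large if `ρ ≥ 0`, and should not exist if `ρ < 0`. -/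
theorem not_isBrillNoetherGeneral (hg : 0 < g) {i : Fin g} {m : ℕ} (hm : 2 ≤ m)
    (h1 : m ≤ (i : ℕ) + 1) (h2 : m ≤ g - i) (hi : m • C.arcClass i = 0) :
    ¬ C.graph.IsBrillNoetherGeneral := by
  intro h
  obtain ⟨t, ht, hcard, htorus⟩ := exists_isTableau_repetition hm h1 h2
  obtain ⟨x, hx⟩ := htorus (g + 1 - m) C hi
  have hs : (m : ℤ) = g - (g + 1 - m) + (1 : ℕ) := by push_cast; ring
  have hnonempty := (C.brillNoetherLocus_nonempty_iff hg hs).mpr ⟨t, x, ht, hx⟩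
  obtain ⟨h3, h4⟩ := h 1 (g + 1 - m) (by rw [C.genus_graph hg, ← hs]; positivity)
  rw [C.genus_graph hg, ← hs] at h3 h4
  push_cast at h3 h4
  by_cases hlt : 2 * m ≤ g
  · obtain ⟨-, h5⟩ := h3 (g - 2 * m) (by push_cast [hlt]; ring)
    obtain ⟨D₀, hD₀, -⟩ := C.exists_divisor hg (g + 1 - m) x
    have h6 := h5 D₀ hD₀
    rw [← hD₀] at h6 hs hx
    rw [C.dimH_univCoverLift_brillNoetherLocus hg D₀ hs] at h6
    have h7 : ((g - (symbols t).card : ℕ) : ENNReal) ≤ (g - 2 * m : ℕ) := by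
      rw [← h6, ← C.dimH_torusLift D₀ (C.torusLift_nonempty D₀ hx)]
      exact le_iSup (fun t : {t : Fin (1 + 1) → Fin m → Fin g // IsTableau t} =>
        dimH (C.torusLift D₀ t.1)) ⟨t, ht⟩
    have h8 : g - (symbols t).card ≤ g - 2 * m := by exact_mod_cast h7
    omega
  · exact hnonempty.ne_empty (h4 (by omega))

end ChainOfCycles

end Tropical

/-- The cycles are indexed from `0` in `ChainOfCycles`, so the `i`-th cycle (`1 ≤ i ≤ g`) is the
one of index `i - 1`. -/
theorem theorem1p1 (g : ℕ) (hg : 1 ≤ g) (C : Tropical.ChainOfCycles g) :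
    C.graph.IsBrillNoetherGeneral ↔
      ∀ (i : ℕ) (_h2 : 2 ≤ i) (_hi : i ≤ g - 1),
        C.torsionOrder ⟨i - 1, by omega⟩ = 0 ∨
          min i (g + 1 - i) < C.torsionOrder ⟨i - 1, by omega⟩ := by
  constructor
  · intro h i h2 hi
    by_contra! hcon
    obtain ⟨h0, hle⟩ := hcon
    have hzero := C.torsionOrder_nsmul _ h0
    refine C.not_isBrillNoetherGeneral hg (C.two_le_of_nsmul (Nat.pos_of_ne_zero h0) hzero)
      ?_ ?_ hzero h
    · simp only
      omega
    · simp only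
      omega
  · intro h
    refine C.isBrillNoetherGeneral_of_torsion hg fun i n hn hzero => ?_
    have h2 := C.two_le_of_nsmul hn hzero
    obtain ⟨h3, h4⟩ := C.torsionOrder_of_nsmul hn hzero
    have hi := i.2
    -- At the two end cycles the minimum is 1, which is less than `n` because `n ≥ 2`.
    by_cases hmid : 1 ≤ (i : ℕ) ∧ (i : ℕ) + 1 ≤ g - 1
    · have h5 := (h (i + 1) (by omega) hmid.2).resolve_left h3
      have h6 : C.torsionOrder ⟨(i : ℕ) + 1 - 1, by omega⟩ = C.torsionOrder i := rfl
      rw [h6] at h5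
      omega
    · omega
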